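/- For a finite group $G$, let $\underline{A}_G$ be the Burnside Tambara functor of $G$: its value at $G/H$ ($H\le G$) is the Burnside ring $A(H)$, i.e. the Grothendieck ring of the semiring of isomorphism classes of finite $H$-sets (with disjoint union and Cartesian product). For $K\le H\le G$ and $g\in G$ its structure maps are the restriction $\mathrm{res}^H_K\colon A(H)\to A(K)$ (restrict the action), the transfer $\mathrm{tr}_K^H\colon A(K)\to A(H)$, $X\mapsto H\times_K X$, the norm $N_K^H\colon A(K)\to A(H)$, which is the unique polynomial extension to $A(K)$ of $X\mapsto \mathrm{Map}_K(H,X)$, and the conjugation $c_{g,H}\colon A(H)\to A(H^g)$, $X\mapsto X^g$, where $H^g=g^{-1}Hg$. An ideal $\mathscr{I}$ of $\underline{A}_G$ is a collection of ring ideals $\mathscr{I}(G/H)\subseteq A(H)$, $H\le G$, such that for all $K\le H\le G$ and $g\in G$: $\mathrm{res}^H_K(\mathscr{I}(G/H))\subseteq\mathscr{I}(G/K)$, $\mathrm{tr}_K^H(\mathscr{I}(G/K))\subseteq\mathscr{I}(G/H)$, $N_K^H(\mathscr{I}(G/K))\subseteq\mathscr{I}(G/H)+N_K^H(0)$ and $c_{g,H}(\mathscr{I}(G/H))\subseteq\mathscr{I}(G/H^g)$.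 The product $\mathscr{I}\mathscr{J}$ of two ideals consists, at $G/H$, of all elements $f_+(ab)$, where $f\colon A\to G/H$ is a map of finite $G$-sets, $a\in\mathscr{I}(A)$ and $b\in\mathscr{J}(A)$ (ideals being extended to arbitrary finite $G$-sets $A$ by taking products over the orbits of $A$); equivalently, of all finite sums of elements $\mathrm{tr}_{K^g}^{H}(c_{g,K}(ab))$ with $K\le G$, $g\in G$, $K^g\le H$, $a\in\mathscr{I}(G/K)$, $b\in\mathscr{J}(G/K)$. An ideal $\mathscr{P}$ is prime if it is proper ($\mathscr{P}\ne\underline{A}_G$) and, for all ideals $\mathscr{I},\mathscr{J}$ of $\underline{A}_G$, $\mathscr{I}\mathscr{J}\subseteq\mathscr{P}$ implies $\mathscr{I}\subseteq\mathscr{P}$ or $\mathscr{J}\subseteq\mathscr{P}$. **Lemma.** Let $G$ be a finite abelian group and $I\le G$. If $\mathscr{P}$ is a prime ideal of $\underline{A}_G$, then its restriction $\mathscr{P}|_I$ to $\underline{A}_I$, given by $\mathscr{P}|_I(I/H)=\mathscr{P}(G/H)\subseteq A(H)$ for $H\le I$, is a prime ideal of $\underline{A}_I$. -/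

import Mathlib

universe u

/-! ## Extending a polynomial map from a commutative monoid to its Grothendieck group -/

section PolynomialExtension

/-- A map `f` from a commutative monoid to an abelian group is polynomial of degree at most `n` if
all its `(n + 1)`-st finite differences vanish. -/
def IsPolynomialMap {M B : Type*} [AddCommMonoid M] [AddCommGroup B] (n : ℕ) (f : M → B) : Prop :=
  ∀ y : M, (fwdDiff y)^[n + 1] f = 0

/-- The value at `x - y` of the polynomial extension of `f`: the Newton expansion of
`k ↦ f (x + k • y)` evaluated at `k = -1` (where the binomial coefficient `k` choose `j`
is `(-1) ^ j`). -/
def newtonValue {M B : Type*} [AddCommMonoid M] [AddCommGroup B] (n : ℕ) (f : M → B) (x y : M) :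
    B :=
  ∑ j ∈ Finset.range (n + 1), (-1 : ℤ) ^ j • ((fwdDiff y)^[j] f) x

theorem newtonValue_add_add {M B : Type*} [AddCommMonoid M] [AddCommGroup B] {n : ℕ} {f : M → B}
    (hf : IsPolynomialMap n f) (x y z : M) :
    newtonValue n f (x + z) (y + z) = newtonValue n f x y := by
  classical
  let D : M → Module.End ℤ (M → B) := fun a => fwdDiff_aux.fwdDiffₗ M B a
  let E : M → Module.End ℤ (M → B) := fun a => D a + 1
  have hE : ∀ a g w, E a g w = g (w + a) := fun a g w => fwdDiff_aux.shiftₗ_apply a g w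
  have hEadd : ∀ a b, E (a + b) = E a * E b := by
    intro a b
    ext g w
    rw [Module.End.mul_apply, hE, hE, hE, add_assoc]
  have hEcomm : ∀ a b, Commute (E a) (E b) := by
    intro a b
    rw [Commute, SemiconjBy, ← hEadd, ← hEadd, add_comm]
  have hDE : ∀ a, D a = E a - 1 := fun a => by simp [E]
  let S : M → Module.End ℤ (M → B) := fun a => ∑ j ∈ Finset.range (n + 1), (1 - E a) ^ j
  have hS : ∀ a w, newtonValue n f w a = S a f w := by
    intro a w
    simp only [newtonValue, S, LinearMap.sum_apply, Finset.sum_apply]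
    refine Finset.sum_congr rfl fun j _ => ?_
    have h1 : (1 - E a) = (-1 : ℤ) • D a := by rw [hDE]; simp
    rw [h1, smul_pow, LinearMap.smul_apply, ← fwdDiff_aux.coe_fwdDiffₗ_pow]
    rfl
  have hkill : ∀ a, ((1 - E a) ^ (n + 1)) f = 0 := by
    intro a
    have h1 : (1 - E a) = (-1 : ℤ) • D a := by rw [hDE]; simp
    rw [h1, smul_pow, LinearMap.smul_apply]
    have := hf a
    rw [← fwdDiff_aux.coe_fwdDiffₗ_pow] at this
    change _ • ((fwdDiff_aux.fwdDiffₗ M B a) ^ (n + 1)) f = 0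
    rw [this, smul_zero]
  have hES : ∀ a, E a * S a = 1 - (1 - E a) ^ (n + 1) := by
    intro a
    have := mul_neg_geom_sum (1 - E a) (n + 1)
    rwa [sub_sub_cancel] at this
  have hESf : ∀ a, E a (S a f) = f := by
    intro a
    rw [← Module.End.mul_apply, hES, LinearMap.sub_apply, hkill, sub_zero]
    rfl
  have hSE : ∀ a b, Commute (S a) (E b) := by
    intro a b
    refine Commute.sum_left _ _ _ fun j _ => ?_
    exact ((Commute.one_left _).sub_left (hEcomm a b)).pow_left j
  have hSS : ∀ a b, Commute (S a) (S b) := by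
    intro a b
    refine Commute.sum_right _ _ _ fun j _ => ?_
    exact ((Commute.one_right _).sub_right (hSE a b)).pow_right j
  have key : S y f = E z (S (y + z) f) := by
    have e1 : S y (E (y + z) (S (y + z) f)) = E z (S (y + z) (E y (S y f))) := by
      simp only [← Module.End.mul_apply]
      congr 1
      rw [hEadd y z, (hEcomm y z).eq, mul_assoc (E z), ← mul_assoc (S y), (hSE y z).eq, mul_assoc]
      congr 1
      rw [← mul_assoc, (hSE y y).eq, mul_assoc, (hSS y (y + z)).eq, ← mul_assoc, ← mul_assoc,
        (hSE (y + z) y).eq]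
    rwa [hESf, hESf] at e1
  rw [hS, hS, key, hE]

/-- The extension of a polynomial map `f : M → B` to the Grothendieck group of `M`. -/
def polynomialExtension {M B : Type*} [AddCommMonoid M] [AddCommGroup B] (n : ℕ) (f : M → B)
    (hf : IsPolynomialMap n f) (x : Algebra.GrothendieckAddGroup M) : B :=
  AddLocalization.liftOn x (fun a b => newtonValue n f a b) (by
    intro a c b d h
    obtain ⟨e, he⟩ := AddLocalization.r_iff_exists.1 h
    simp only at he ⊢
    rw [← newtonValue_add_add hf a b (e + d), ← newtonValue_add_add hf c d (e + b)]
    have h1 : a + (↑e + ↑d) = c + (↑e + ↑b) := by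
      calc a + (↑e + ↑d) = ↑e + (↑d + a) := by abel
        _ = ↑e + (↑b + c) := he
        _ = c + (↑e + ↑b) := by abel
    have h2 : (b : M) + (↑e + ↑d) = ↑d + (↑e + ↑b) := by abel
    rw [h1, h2])

theorem polynomialExtension_sub {M B : Type*} [AddCommMonoid M] [AddCommGroup B] (n : ℕ)
    (f : M → B) (hf : IsPolynomialMap n f) (x y : M) :
    polynomialExtension n f hf
      (Algebra.GrothendieckAddGroup.of x - Algebra.GrothendieckAddGroup.of y) =
      newtonValue n f x y := by
  have : (Algebra.GrothendieckAddGroup.of x - Algebra.GrothendieckAddGroup.of y :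
      Algebra.GrothendieckAddGroup M) = AddLocalization.mk x ⟨y, AddSubmonoid.mem_top y⟩ := by
    simp only [Algebra.GrothendieckAddGroup.of]
    change AddLocalization.addMonoidOf ⊤ x - AddLocalization.addMonoidOf ⊤ y = _
    rw [← AddLocalization.mk_zero_eq_addMonoidOf_mk, ← AddLocalization.mk_zero_eq_addMonoidOf_mk,
      Algebra.GrothendieckAddGroup.mk_sub_mk]
    simp
  rw [this]
  rfl

/-- The extension agrees with the original map on the monoid. -/
theorem polynomialExtension_of {M B : Type*} [AddCommMonoid M] [AddCommGroup B] (n : ℕ)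
    (f : M → B) (hf : IsPolynomialMap n f) (x : M) :
    polynomialExtension n f hf (Algebra.GrothendieckAddGroup.of x) = f x := by
  have h := polynomialExtension_sub n f hf x 0
  rw [map_zero, sub_zero] at h
  rw [h, newtonValue, Finset.sum_range_succ', Finset.sum_eq_zero]
  · simp
  · intro j _
    have h0 : fwdDiff (0 : M) f = 0 := by
      funext w
      simp [fwdDiff]
    have hz : ∀ k : ℕ, (fwdDiff (0 : M))^[k] (0 : M → B) = 0 := by
      intro k
      rw [← fwdDiff_aux.coe_fwdDiffₗ_pow, map_zero]
    rw [Function.iterate_succ_apply, h0, hz]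
    simp

end PolynomialExtension

/-! ## Finite `G`-sets -/

/-- A finite set with an action of the group `G`. -/
structure FinGSet (G : Type u) [Group G] where
  carrier : Type u
  [action : MulAction G carrier]
  [finite : Finite carrier]

attribute [instance] FinGSet.action FinGSet.finite

namespace FinGSet

/-- Isomorphism of finite `G`-sets: there is an equivariant bijection. -/
instance isoSetoid (G : Type u) [Group G] : Setoid (FinGSet G) where
  r X Y := ∃ e : X.carrier ≃ Y.carrier, ∀ (g : G) (x : X.carrier), e (g • x) = g • e x
  iseqv :=
    { refl := fun X => ⟨Equiv.refl _, fun _ _ => rfl⟩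
      symm := by
        rintro X Y ⟨e, he⟩
        exact ⟨e.symm, fun g y => by rw [Equiv.symm_apply_eq, he, Equiv.apply_symm_apply]⟩
      trans := by
        rintro X Y Z ⟨e, he⟩ ⟨f, hf⟩
        exact ⟨e.trans f, fun g x => by simp [he, hf]⟩ }

/-- The disjoint union. -/
def sum {G : Type u} [Group G] (X Y : FinGSet G) : FinGSet G where
  carrier := X.carrier ⊕ Y.carrier

/-- The Cartesian product with the diagonal action. -/
def prod {G : Type u} [Group G] (X Y : FinGSet G) : FinGSet G where
  carrier := X.carrier × Y.carrier

/-- The empty `G`-set. -/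
def empty (G : Type u) [Group G] : FinGSet G where
  carrier := PEmpty
  action :=
    { smul := fun _ x => x
      one_smul := fun _ => rfl
      mul_smul := fun _ _ _ => rfl }

/-- The one-point `G`-set. -/
def point (G : Type u) [Group G] : FinGSet G where
  carrier := PUnit

/-- A finite `H`-set with the action pulled back along a group homomorphism `φ : K →* H`. -/
def res {K H : Type u} [Group K] [Group H] (φ : K →* H) (X : FinGSet H) : FinGSet K where
  carrier := X.carrier
  action := MulAction.compHom X.carrier φ

/-- The relation on `H × X` identifying `(h φ(k)⁻¹, k x)` with `(h, x)`. -/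
def indSetoid {K H : Type u} [Group K] [Group H] (φ : K →* H) (X : FinGSet K) :
    Setoid (H × X.carrier) where
  r p q := ∃ k : K, q = (p.1 * (φ k)⁻¹, k • p.2)
  iseqv :=
    { refl := fun p => ⟨1, by simp⟩
      symm := by
        rintro p q ⟨k, rfl⟩
        exact ⟨k⁻¹, by simp⟩
      trans := by
        rintro p q r ⟨k, rfl⟩ ⟨l, rfl⟩
        exact ⟨l * k, by simp [mul_smul, mul_assoc]⟩ }

/-- The induced `H`-set `H ×_K X`, where `K` acts on `H` through `φ : K →* H`. -/
def ind {K H : Type u} [Group K] [Group H] [Finite H] (φ : K →* H) (X : FinGSet K) :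
    FinGSet H where
  carrier := Quotient (indSetoid φ X)
  action :=
    { smul := fun a => Quotient.map (fun p => (a * p.1, p.2)) (by
        rintro p q ⟨k, rfl⟩
        exact ⟨k, by simp [mul_assoc]⟩)
      one_smul := by
        rintro ⟨p⟩
        exact congrArg (Quotient.mk (indSetoid φ X)) (Prod.ext (one_mul p.1) rfl)
      mul_smul := by
        rintro a b ⟨p⟩
        exact congrArg (Quotient.mk (indSetoid φ X)) (Prod.ext (mul_assoc a b p.1) rfl) }

/-- The coinduced `H`-set `Map_K(H, X)` of `K`-equivariant maps `f : H → X`, where `K` acts on `H`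
by left multiplication through `φ : K →* H`; an element `a` of `H` acts by `(a f)(h) = f(h a)`. -/
def coind {K H : Type u} [Group K] [Group H] [Finite H] (φ : K →* H) (X : FinGSet K) :
    FinGSet H where
  carrier := {f : H → X.carrier // ∀ (k : K) (h : H), f (φ k * h) = k • f h}
  action :=
    { smul := fun a f => ⟨fun h => f.1 (h * a), fun k h => by
        change f.1 (φ k * h * a) = k • f.1 (h * a)
        rw [mul_assoc, f.2]⟩
      one_smul := fun f => Subtype.ext (funext fun h => congrArg f.1 (mul_one h))
      mul_smul := fun a b f =>
        Subtype.ext (funext fun h => congrArg f.1 (mul_assoc h a b).symm) }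

theorem sum_congr {G : Type u} [Group G] {X X' Y Y' : FinGSet G} (hX : X ≈ X') (hY : Y ≈ Y') :
    X.sum Y ≈ X'.sum Y' := by
  obtain ⟨e, he⟩ := hX
  obtain ⟨f, hf⟩ := hY
  refine ⟨Equiv.sumCongr e f, ?_⟩
  rintro g (x | y)
  · exact congrArg Sum.inl (he g x)
  · exact congrArg Sum.inr (hf g y)

theorem prod_congr {G : Type u} [Group G] {X X' Y Y' : FinGSet G} (hX : X ≈ X') (hY : Y ≈ Y') :
    X.prod Y ≈ X'.prod Y' := by
  obtain ⟨e, he⟩ := hX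
  obtain ⟨f, hf⟩ := hY
  refine ⟨Equiv.prodCongr e f, ?_⟩
  rintro g ⟨x, y⟩
  exact Prod.ext (he g x) (hf g y)

theorem res_congr {K H : Type u} [Group K] [Group H] (φ : K →* H) {X Y : FinGSet H} (h : X ≈ Y) :
    res φ X ≈ res φ Y := by
  obtain ⟨e, he⟩ := h
  exact ⟨e, fun k x => he (φ k) x⟩

theorem ind_congr {K H : Type u} [Group K] [Group H] [Finite H] (φ : K →* H) {X Y : FinGSet K}
    (h : X ≈ Y) : ind φ X ≈ ind φ Y := by
  obtain ⟨e, he⟩ := h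
  refine ⟨Quotient.congr (Equiv.prodCongr (Equiv.refl H) e) ?_, ?_⟩
  · rintro ⟨a, x⟩ ⟨b, y⟩
    refine exists_congr fun k => ?_
    simp only [Equiv.prodCongr_apply, Prod.map, Equiv.refl_apply, Prod.mk.injEq, ← he,
      e.apply_eq_iff_eq]
  · rintro a ⟨p⟩
    rfl

theorem coind_congr {K H : Type u} [Group K] [Group H] [Finite H] (φ : K →* H) {X Y : FinGSet K}
    (h : X ≈ Y) : coind φ X ≈ coind φ Y := by
  obtain ⟨e, he⟩ := h
  refine ⟨Equiv.subtypeEquiv (Equiv.arrowCongr (Equiv.refl H) e) ?_, ?_⟩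
  · intro f
    refine forall_congr' fun k => forall_congr' fun h => ?_
    simp only [Equiv.arrowCongr_apply, Function.comp, Equiv.refl_symm, Equiv.refl_apply, ← he,
      e.apply_eq_iff_eq]
  · intro a f
    rfl

end FinGSet

/-! ## The Burnside ring -/

/-- Isomorphism classes of finite `G`-sets. -/
def BurnsideSemiring (G : Type u) [Group G] : Type (u + 1) :=
  Quotient (FinGSet.isoSetoid G)

namespace BurnsideSemiring

/-- The isomorphism class of a finite `G`-set. -/
def mk {G : Type u} [Group G] (X : FinGSet G) : BurnsideSemiring G :=
  Quotient.mk (FinGSet.isoSetoid G) X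

/-- Addition is disjoint union. -/
instance (G : Type u) [Group G] : Add (BurnsideSemiring G) :=
  ⟨Quotient.map₂ FinGSet.sum fun _ _ h _ _ h' => FinGSet.sum_congr h h'⟩

/-- Multiplication is the Cartesian product. -/
instance (G : Type u) [Group G] : Mul (BurnsideSemiring G) :=
  ⟨Quotient.map₂ FinGSet.prod fun _ _ h _ _ h' => FinGSet.prod_congr h h'⟩

instance (G : Type u) [Group G] : Zero (BurnsideSemiring G) := ⟨mk (FinGSet.empty G)⟩

instance (G : Type u) [Group G] : One (BurnsideSemiring G) := ⟨mk (FinGSet.point G)⟩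

instance (G : Type u) [Group G] : CommSemiring (BurnsideSemiring G) where
  nsmul := nsmulRec
  add_assoc := by
    rintro ⟨X⟩ ⟨Y⟩ ⟨Z⟩
    refine Quotient.sound ⟨Equiv.sumAssoc _ _ _, ?_⟩
    rintro g ((x | y) | z) <;> rfl
  zero_add := by
    rintro ⟨X⟩
    refine Quotient.sound ⟨Equiv.emptySum PEmpty _, ?_⟩
    rintro g (x | x)
    · exact x.elim
    · rfl
  add_zero := by
    rintro ⟨X⟩
    refine Quotient.sound ⟨Equiv.sumEmpty _ PEmpty, ?_⟩
    rintro g (x | x)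
    · rfl
    · exact x.elim
  add_comm := by
    rintro ⟨X⟩ ⟨Y⟩
    refine Quotient.sound ⟨Equiv.sumComm _ _, ?_⟩
    rintro g (x | x) <;> rfl
  left_distrib := by
    rintro ⟨X⟩ ⟨Y⟩ ⟨Z⟩
    refine Quotient.sound ⟨Equiv.prodSumDistrib _ _ _, ?_⟩
    rintro g ⟨x, y | z⟩ <;> rfl
  right_distrib := by
    rintro ⟨X⟩ ⟨Y⟩ ⟨Z⟩
    refine Quotient.sound ⟨Equiv.sumProdDistrib _ _ _, ?_⟩
    rintro g ⟨x | y, z⟩ <;> rfl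
  zero_mul := by
    rintro ⟨X⟩
    exact Quotient.sound ⟨Equiv.pemptyProd _, fun g x => x.1.elim⟩
  mul_zero := by
    rintro ⟨X⟩
    exact Quotient.sound ⟨Equiv.prodPEmpty _, fun g x => x.2.elim⟩
  mul_assoc := by
    rintro ⟨X⟩ ⟨Y⟩ ⟨Z⟩
    exact Quotient.sound ⟨Equiv.prodAssoc _ _ _, fun _ _ => rfl⟩
  one_mul := by
    rintro ⟨X⟩
    exact Quotient.sound ⟨Equiv.punitProd _, fun _ _ => rfl⟩
  mul_one := by
    rintro ⟨X⟩
    exact Quotient.sound ⟨Equiv.prodPUnit _, fun _ _ => rfl⟩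
  mul_comm := by
    rintro ⟨X⟩ ⟨Y⟩
    exact Quotient.sound ⟨Equiv.prodComm _ _, fun _ _ => rfl⟩

/-- Restriction along `φ : K →* H` on isomorphism classes. -/
def res {K H : Type u} [Group K] [Group H] (φ : K →* H) :
    BurnsideSemiring H →+* BurnsideSemiring K where
  toFun := Quotient.map (FinGSet.res φ) fun _ _ h => FinGSet.res_congr φ h
  map_one' := Quotient.sound ⟨Equiv.refl _, fun _ _ => rfl⟩
  map_zero' := Quotient.sound ⟨Equiv.refl _, fun _ x => x.elim⟩
  map_add' := by
    rintro ⟨X⟩ ⟨Y⟩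
    refine Quotient.sound ⟨Equiv.refl _, ?_⟩
    rintro g (x | x) <;> rfl
  map_mul' := by
    rintro ⟨X⟩ ⟨Y⟩
    exact Quotient.sound ⟨Equiv.refl _, fun _ _ => rfl⟩

/-- Induction `X ↦ H ×_K X` along `φ : K →* H` on isomorphism classes. -/
def ind {K H : Type u} [Group K] [Group H] [Finite H] (φ : K →* H) :
    BurnsideSemiring K →+ BurnsideSemiring H where
  toFun := Quotient.map (FinGSet.ind φ) fun _ _ h => FinGSet.ind_congr φ h
  map_zero' := by
    refine Quotient.sound ⟨⟨fun q => ?_, fun x => x.elim, ?_, fun x => x.elim⟩, ?_⟩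
    · exact Quotient.lift (fun p => (p.2 : PEmpty)) (fun p _ _ => PEmpty.elim p.2) q
    · rintro ⟨p⟩
      exact PEmpty.elim p.2
    · rintro a ⟨p⟩
      exact PEmpty.elim p.2
  map_add' := by
    rintro ⟨X⟩ ⟨Y⟩
    refine Setoid.symm (a := (FinGSet.ind φ X).sum (FinGSet.ind φ Y)) ?_ |> Quotient.sound
    let F : (FinGSet.ind φ X).carrier ⊕ (FinGSet.ind φ Y).carrier →
        (FinGSet.ind φ (X.sum Y)).carrier :=
      Sum.elim
        (Quotient.map (fun p => (p.1, Sum.inl p.2)) (by rintro p q ⟨k, rfl⟩; exact ⟨k, rfl⟩))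
        (Quotient.map (fun p => (p.1, Sum.inr p.2)) (by rintro p q ⟨k, rfl⟩; exact ⟨k, rfl⟩))
    refine ⟨Equiv.ofBijective F ⟨?_, ?_⟩, ?_⟩
    · rintro (⟨⟨a, x⟩⟩ | ⟨⟨a, x⟩⟩) (⟨⟨b, y⟩⟩ | ⟨⟨b, y⟩⟩) h
      · obtain ⟨k, hk⟩ := Quotient.exact h
        have h1 := congrArg Prod.fst hk
        have h2 : (Sum.inl y : X.carrier ⊕ Y.carrier) = Sum.inl (k • x) := congrArg Prod.snd hk
        exact congrArg Sum.inl (Quotient.sound ⟨k, Prod.ext h1 (Sum.inl_injective h2)⟩)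
      · obtain ⟨k, hk⟩ := Quotient.exact h
        have h2 : (Sum.inr y : X.carrier ⊕ Y.carrier) = Sum.inl (k • x) := congrArg Prod.snd hk
        cases h2
      · obtain ⟨k, hk⟩ := Quotient.exact h
        have h2 : (Sum.inl y : X.carrier ⊕ Y.carrier) = Sum.inr (k • x) := congrArg Prod.snd hk
        cases h2
      · obtain ⟨k, hk⟩ := Quotient.exact h
        have h1 := congrArg Prod.fst hk
        have h2 : (Sum.inr y : X.carrier ⊕ Y.carrier) = Sum.inr (k • x) := congrArg Prod.snd hk
        exact congrArg Sum.inr (Quotient.sound ⟨k, Prod.ext h1 (Sum.inr_injective h2)⟩)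
    · rintro ⟨⟨a, x | y⟩⟩
      · exact ⟨Sum.inl (Quotient.mk _ (a, x)), rfl⟩
      · exact ⟨Sum.inr (Quotient.mk _ (a, y)), rfl⟩
    · rintro a (⟨⟨b, x⟩⟩ | ⟨⟨b, x⟩⟩)
      · exact Quotient.sound ⟨1, Prod.ext (by simp) (one_smul K (Sum.inl x : (X.sum Y).carrier)).symm⟩
      · exact Quotient.sound ⟨1, Prod.ext (by simp) (one_smul K (Sum.inr x : (X.sum Y).carrier)).symm⟩

end BurnsideSemiring

/-- The Burnside ring of `G`: formal differences of isomorphism classes of finite `G`-sets. -/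
def BurnsideRing (G : Type u) [Group G] : Type (u + 1) :=
  Algebra.GrothendieckAddGroup (BurnsideSemiring G)

namespace BurnsideRing

noncomputable instance (G : Type u) [Group G] : AddCommGroup (BurnsideRing G) :=
  inferInstanceAs (AddCommGroup (Algebra.GrothendieckAddGroup (BurnsideSemiring G)))

/-- The canonical map from isomorphism classes of finite `G`-sets to the Burnside ring. -/
noncomputable def ofClass (G : Type u) [Group G] : BurnsideSemiring G →+ BurnsideRing G :=
  Algebra.GrothendieckAddGroup.of

/-- The class of a finite `G`-set in the Burnside ring. -/
noncomputable def of {G : Type u} [Group G] (X : FinGSet G) : BurnsideRing G :=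
  ofClass G (BurnsideSemiring.mk X)

/-- The universal property of the Grothendieck group. -/
noncomputable def lift {G : Type u} [Group G] {B : Type*} [AddCommGroup B]
    (f : BurnsideSemiring G →+ B) : BurnsideRing G →+ B :=
  Algebra.GrothendieckAddGroup.lift f

theorem lift_ofClass {G : Type u} [Group G] {B : Type*} [AddCommGroup B]
    (f : BurnsideSemiring G →+ B) (x : BurnsideSemiring G) : lift f (ofClass G x) = f x :=
  DFunLike.congr_fun (Algebra.GrothendieckAddGroup.lift.symm_apply_apply f) x

theorem hom_ext {G : Type u} [Group G] {B : Type*} [AddCommGroup B] {f g : BurnsideRing G →+ B}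
    (h : ∀ x, f (ofClass G x) = g (ofClass G x)) : f = g :=
  Algebra.GrothendieckAddGroup.lift.symm.injective (AddMonoidHom.ext h)

theorem exists_sub {G : Type u} [Group G] (x : BurnsideRing G) :
    ∃ a b : BurnsideSemiring G, x = ofClass G a - ofClass G b := by
  let S : AddSubgroup (BurnsideRing G) :=
    { carrier := {x | ∃ a b : BurnsideSemiring G, x = ofClass G a - ofClass G b}
      zero_mem' := ⟨0, 0, by simp⟩
      add_mem' := by
        rintro _ _ ⟨a, b, rfl⟩ ⟨c, d, rfl⟩
        exact ⟨a + c, b + d, by simp only [map_add]; abel⟩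
      neg_mem' := by
        rintro _ ⟨a, b, rfl⟩
        exact ⟨b, a, by abel⟩ }
  have h : QuotientAddGroup.mk' S = 0 := hom_ext fun a => by
    rw [AddMonoidHom.zero_apply, QuotientAddGroup.mk'_apply, QuotientAddGroup.eq_zero_iff]
    exact ⟨a, 0, by simp⟩
  have hx := DFunLike.congr_fun h x
  rwa [AddMonoidHom.zero_apply, QuotientAddGroup.mk'_apply, QuotientAddGroup.eq_zero_iff] at hx

/-- The multiplication, as the biadditive extension of the product of `G`-sets. -/
noncomputable def mulHom (G : Type u) [Group G] :
    BurnsideRing G →+ BurnsideRing G →+ BurnsideRing G :=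
  lift
    { toFun := fun x => lift ((ofClass G).comp (AddMonoidHom.mulLeft x))
      map_zero' := hom_ext fun y => by simp [lift_ofClass]
      map_add' := fun x x' => hom_ext fun y => by simp [lift_ofClass, add_mul] }

theorem mulHom_ofClass {G : Type u} [Group G] (x y : BurnsideSemiring G) :
    mulHom G (ofClass G x) (ofClass G y) = ofClass G (x * y) := by
  simp [mulHom, lift_ofClass]

noncomputable instance (G : Type u) [Group G] : Mul (BurnsideRing G) := ⟨fun x y => mulHom G x y⟩

noncomputable instance (G : Type u) [Group G] : One (BurnsideRing G) := ⟨ofClass G 1⟩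

theorem mul_def {G : Type u} [Group G] (x y : BurnsideRing G) : x * y = mulHom G x y := rfl

theorem one_def {G : Type u} [Group G] : (1 : BurnsideRing G) = ofClass G 1 := rfl

noncomputable instance (G : Type u) [Group G] : CommRing (BurnsideRing G) :=
  { (inferInstance : AddCommGroup (BurnsideRing G)), (inferInstance : Mul (BurnsideRing G)),
    (inferInstance : One (BurnsideRing G)) with
    left_distrib := fun x y z => map_add (mulHom G x) y z
    right_distrib := fun x y z => by
      change mulHom G (x + y) z = mulHom G x z + mulHom G y z
      rw [map_add, AddMonoidHom.add_apply]
    zero_mul := fun x => by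
      change mulHom G 0 x = 0
      rw [map_zero, AddMonoidHom.zero_apply]
    mul_zero := fun x => map_zero (mulHom G x)
    mul_assoc := fun x y z => by
      change mulHom G (mulHom G x y) z = mulHom G x (mulHom G y z)
      obtain ⟨a, a', rfl⟩ := exists_sub x
      obtain ⟨b, b', rfl⟩ := exists_sub y
      obtain ⟨c, c', rfl⟩ := exists_sub z
      simp only [map_sub, AddMonoidHom.sub_apply, mulHom_ofClass, mul_assoc]
    one_mul := fun x => by
      have h : mulHom G (ofClass G 1) = AddMonoidHom.id _ :=
        hom_ext fun y => by simp [mulHom_ofClass]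
      exact DFunLike.congr_fun h x
    mul_one := fun x => by
      have h : (mulHom G).flip (ofClass G 1) = AddMonoidHom.id _ :=
        hom_ext fun y => by simp [mulHom_ofClass]
      exact DFunLike.congr_fun h x
    mul_comm := fun x y => by
      have h : mulHom G = (mulHom G).flip :=
        hom_ext fun a => hom_ext fun b => by simp [mulHom_ofClass, mul_comm]
      exact DFunLike.congr_fun (DFunLike.congr_fun h x) y }

end BurnsideRing

/-! ## The norm of a finite `K`-set is a polynomial map -/

namespace FinGSet

/-- The `H`-subset of `Map_K(H, X ⊔ W)` of maps meeting every fibre of `c : W → {0, …, m - 1}`. -/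
def hit {K H : Type u} [Group K] [Group H] [Finite H] (φ : K →* H) (m : ℕ) (W : FinGSet K)
    (c : W.carrier → Fin m) (X : FinGSet K) : FinGSet H where
  carrier := {f : (coind φ (X.sum W)).carrier // ∀ i, ∃ h w, f.1 h = Sum.inr w ∧ c w = i}
  action :=
    { smul := fun a f => ⟨a • f.1, fun i => by
        obtain ⟨h, w, hw, hc⟩ := f.2 i
        refine ⟨h * a⁻¹, w, ?_, hc⟩
        change f.1.1 (h * a⁻¹ * a) = _
        rwa [inv_mul_cancel_right]⟩
      one_smul := fun f => Subtype.ext (one_smul H f.1)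
      mul_smul := fun a b f => Subtype.ext (mul_smul a b f.1) }

theorem hit_congr {K H : Type u} [Group K] [Group H] [Finite H] (φ : K →* H) (m : ℕ)
    (W : FinGSet K) (c : W.carrier → Fin m) {X Y : FinGSet K} (h : X ≈ Y) :
    hit φ m W c X ≈ hit φ m W c Y := by
  obtain ⟨e, he⟩ := h
  have key : ∀ (k : K) (z : X.carrier ⊕ W.carrier),
      Equiv.sumCongr e (Equiv.refl W.carrier) (k • z) =
        k • Equiv.sumCongr e (Equiv.refl W.carrier) z := by
    rintro k (x | w)
    · exact congrArg Sum.inl (he k x)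
    · rfl
  refine ⟨Equiv.subtypeEquiv (Equiv.subtypeEquiv (Equiv.arrowCongr (Equiv.refl H)
    (Equiv.sumCongr e (Equiv.refl W.carrier))) ?_) ?_, ?_⟩
  · intro f
    refine forall_congr' fun k => forall_congr' fun h => ?_
    exact (Equiv.apply_eq_iff_eq (Equiv.sumCongr e (Equiv.refl W.carrier))).symm.trans
      (Eq.congr_right (key k (f h)))
  · intro f
    refine forall_congr' fun i => exists_congr fun h => exists_congr fun w => and_congr_left' ?_
    change _ ↔ Equiv.sumCongr e (Equiv.refl W.carrier) (f.1 h) = Sum.inr w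
    rcases f.1 h with x | w'
    · exact ⟨fun h => (Sum.inl_ne_inr h).elim, fun h => (Sum.inl_ne_inr h).elim⟩
    · exact ⟨fun h => congrArg Sum.inr (Sum.inr_injective h),
        fun h => congrArg Sum.inr (Sum.inr_injective h)⟩
  · intro a f
    rfl

theorem hit_zero {K H : Type u} [Group K] [Group H] [Finite H] (φ : K →* H) (X : FinGSet K) :
    hit φ 0 (empty K) (fun w => PEmpty.elim w) X ≈ coind φ X := by
  obtain ⟨e, he⟩ : coind φ (X.sum (empty K)) ≈ coind φ X := by
    refine coind_congr φ ⟨Equiv.sumEmpty _ PEmpty, ?_⟩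
    rintro g (x | x)
    · rfl
    · exact x.elim
  exact ⟨(Equiv.subtypeUnivEquiv fun f i => i.elim0).trans e, fun a f => he a f.1⟩

theorem hit_eq_empty {K H : Type u} [Group K] [Group H] [Finite H] (φ : K →* H) {m : ℕ}
    (hm : Nat.card H < m) (W : FinGSet K) (c : W.carrier → Fin m) (X : FinGSet K) :
    hit φ m W c X ≈ empty H := by
  have : IsEmpty (hit φ m W c X).carrier := by
    refine ⟨fun f => ?_⟩
    choose h w hw hc using f.2
    have hinj : Function.Injective h := by
      intro i j hij
      have h1 := hw i
      rw [hij, hw j] at h1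
      rw [← hc i, ← hc j, Sum.inr_injective h1]
    have := Nat.card_le_card_of_injective h hinj
    rw [Nat.card_fin] at this
    omega
  exact ⟨Equiv.equivPEmpty _, fun a f => isEmptyElim f⟩

theorem hit_sum {K H : Type u} [Group K] [Group H] [Finite H] (φ : K →* H) (m : ℕ)
    (W : FinGSet K) (c : W.carrier → Fin m) (X Y : FinGSet K) :
    (hit φ m W c X).sum (hit φ (m + 1) (Y.sum W)
      (Sum.elim (fun _ => Fin.last m) fun w => (c w).castSucc) X) ≈ hit φ m W c (X.sum Y) := by
  let s : X.carrier ⊕ W.carrier → (X.carrier ⊕ Y.carrier) ⊕ W.carrier := Sum.map Sum.inl id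
  let t : X.carrier ⊕ (Y.carrier ⊕ W.carrier) → (X.carrier ⊕ Y.carrier) ⊕ W.carrier :=
    (Equiv.sumAssoc X.carrier Y.carrier W.carrier).symm
  have hs : Function.Injective s := Sum.inl_injective.sumMap Function.injective_id
  have ht : Function.Injective t := Equiv.injective _
  have hsk : ∀ (k : K) z, s (k • z) = k • s z := by rintro k (x | w) <;> rfl
  have htk : ∀ (k : K) z, t (k • z) = k • t z := by rintro k (x | y | w) <;> rfl
  let F1 : (hit φ m W c X).carrier → (hit φ m W c (X.sum Y)).carrier := fun f =>
    ⟨⟨fun h => s (f.1.1 h), fun k h => (congrArg s (f.1.2 k h)).trans (hsk k _)⟩, fun i => by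
      obtain ⟨h, w, hw, hc⟩ := f.2 i
      exact ⟨h, w, congrArg s hw, hc⟩⟩
  let F2 : (hit φ (m + 1) (Y.sum W) (Sum.elim (fun _ => Fin.last m) fun w => (c w).castSucc)
      X).carrier → (hit φ m W c (X.sum Y)).carrier := fun f =>
    ⟨⟨fun h => t (f.1.1 h), fun k h => (congrArg t (f.1.2 k h)).trans (htk k _)⟩, fun i => by
      obtain ⟨h, w, hw, hc⟩ := f.2 i.castSucc
      rcases w with y | w
      · exact absurd hc.symm (Fin.castSucc_lt_last i).ne
      · exact ⟨h, w, congrArg t hw, Fin.castSucc_injective _ hc⟩⟩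
  have hF2 : ∀ f, ∃ h y, (F2 f).1.1 h = Sum.inl (Sum.inr y) := by
    intro f
    obtain ⟨h, w, hw, hc⟩ := f.2 (Fin.last m)
    rcases w with y | w
    · exact ⟨h, y, congrArg t hw⟩
    · exact absurd hc (Fin.castSucc_lt_last _).ne
  have hF1 : ∀ f h y, (F1 f).1.1 h ≠ Sum.inl (Sum.inr y) := by
    intro f h y hy
    change s (f.1.1 h) = _ at hy
    rcases hz : f.1.1 h with x | w
    · rw [hz] at hy
      cases hy
    · rw [hz] at hy
      cases hy
  refine ⟨Equiv.ofBijective (Sum.elim F1 F2) ⟨?_, ?_⟩, ?_⟩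
  · rintro (f | f) (g | g) h
    · refine congrArg Sum.inl (Subtype.ext (Subtype.ext (funext fun a => hs ?_)))
      exact congrFun (congrArg (fun q => q.1.1) h) a
    · obtain ⟨a, y, hy⟩ := hF2 g
      exact absurd ((congrFun (congrArg (fun q => q.1.1) h) a).trans hy) (hF1 f a y)
    · obtain ⟨a, y, hy⟩ := hF2 f
      exact absurd ((congrFun (congrArg (fun q => q.1.1) h) a).symm.trans hy) (hF1 g a y)
    · refine congrArg Sum.inr (Subtype.ext (Subtype.ext (funext fun a => ht ?_)))
      exact congrFun (congrArg (fun q => q.1.1) h) a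
  · intro f
    by_cases hf : ∃ h y, f.1.1 h = Sum.inl (Sum.inr y)
    · have hsurj : ∀ h, ∃ z, t z = f.1.1 h := fun h => (Equiv.surjective _) _
      choose g hg using hsurj
      refine ⟨Sum.inr ⟨⟨g, fun k h => ht ?_⟩, fun i => ?_⟩,
        Subtype.ext (Subtype.ext (funext hg))⟩
      · rw [hg, f.1.2]
        exact (congrArg (k • ·) (hg h).symm).trans (htk k (g h)).symm
      · refine Fin.lastCases ?_ (fun i => ?_) i
        · obtain ⟨h, y, hy⟩ := hf
          exact ⟨h, Sum.inl y, ht ((hg h).trans hy), rfl⟩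
        · obtain ⟨h, w, hw, hc⟩ := f.2 i
          exact ⟨h, Sum.inr w, ht ((hg h).trans hw), congrArg Fin.castSucc hc⟩
    · have hsurj : ∀ h, ∃ z, s z = f.1.1 h := by
        intro h
        rcases hz : f.1.1 h with (x | y) | w
        · exact ⟨Sum.inl x, rfl⟩
        · exact absurd ⟨h, y, hz⟩ hf
        · exact ⟨Sum.inr w, rfl⟩
      choose g hg using hsurj
      refine ⟨Sum.inl ⟨⟨g, fun k h => hs ?_⟩, fun i => ?_⟩,
        Subtype.ext (Subtype.ext (funext hg))⟩
      · rw [hg, f.1.2]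
        exact (congrArg (k • ·) (hg h).symm).trans (hsk k (g h)).symm
      · obtain ⟨h, w, hw, hc⟩ := f.2 i
        exact ⟨h, w, hs ((hg h).trans hw), hc⟩
  · rintro a (f | f) <;> rfl

end FinGSet

namespace BurnsideSemiring

/-- The class of `Map_K(H, X)` in the Burnside ring of `H`, for an isomorphism class `X` of finite
`K`-sets. -/
noncomputable def coind {K H : Type u} [Group K] [Group H] [Finite H] (φ : K →* H)
    (x : BurnsideSemiring K) : BurnsideRing H :=
  Quotient.lift (fun X => BurnsideRing.of (FinGSet.coind φ X))
    (fun _ _ h => congrArg (BurnsideRing.ofClass H) (Quotient.sound (FinGSet.coind_congr φ h))) x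

theorem isPolynomialMap_coind {K H : Type u} [Group K] [Group H] [Finite H] (φ : K →* H) :
    IsPolynomialMap (Nat.card H) (coind φ) := by
  let g : ∀ (m : ℕ) (W : FinGSet K), (W.carrier → Fin m) → BurnsideSemiring K → BurnsideRing H :=
    fun m W c => Quotient.lift (fun X => BurnsideRing.of (FinGSet.hit φ m W c X))
      (fun _ _ h => congrArg (BurnsideRing.ofClass H) (Quotient.sound (FinGSet.hit_congr φ m W c h)))
  have h0 : coind φ = g 0 (FinGSet.empty K) (fun w => PEmpty.elim w) := by
    funext x
    obtain ⟨X⟩ := x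
    exact congrArg (BurnsideRing.ofClass H) (Quotient.sound (Setoid.symm (FinGSet.hit_zero φ X)))
  have hstep : ∀ m W c (Y : FinGSet K), fwdDiff (mk Y) (g m W c) =
      g (m + 1) (Y.sum W) (Sum.elim (fun _ => Fin.last m) fun w => (c w).castSucc) := by
    intro m W c Y
    funext x
    obtain ⟨X⟩ := x
    refine sub_eq_iff_eq_add'.2 ?_
    refine Eq.trans ?_ (map_add (BurnsideRing.ofClass H) _ _)
    exact congrArg (BurnsideRing.ofClass H)
      (Quotient.sound (Setoid.symm (FinGSet.hit_sum φ m W c X Y)))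
  have hend : ∀ m W c, Nat.card H < m → g m W c = 0 := by
    intro m W c hm
    funext x
    obtain ⟨X⟩ := x
    refine Eq.trans ?_ (map_zero (BurnsideRing.ofClass H))
    exact congrArg (BurnsideRing.ofClass H) (Quotient.sound (FinGSet.hit_eq_empty φ hm W c X))
  have hind : ∀ (Y : FinGSet K) d m W c, m + d = Nat.card H + 1 →
      (fwdDiff (mk Y))^[d] (g m W c) = 0 := by
    intro Y d
    induction d with
    | zero =>
      intro m W c h
      exact hend m W c (by omega)
    | succ d ih =>
      intro m W c h
      rw [Function.iterate_succ_apply, hstep]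
      exact ih _ _ _ (by omega)
  rintro ⟨Y⟩
  rw [h0]
  exact hind Y _ _ _ _ (by omega)

end BurnsideSemiring

namespace BurnsideRing

/-- Restriction along `φ : K →* H`: the ring homomorphism sending the class of an `H`-set to the
class of the same set with the action pulled back along `φ`. -/
noncomputable def res {K H : Type u} [Group K] [Group H] (φ : K →* H) :
    BurnsideRing H →+* BurnsideRing K :=
  { lift ((ofClass K).comp (BurnsideSemiring.res φ).toAddMonoidHom) with
    map_one' := by
      change lift _ (ofClass H 1) = ofClass K 1
      rw [lift_ofClass]
      exact congrArg (ofClass K) (map_one (BurnsideSemiring.res φ))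
    map_mul' := fun x y => by
      change lift ((ofClass K).comp (BurnsideSemiring.res φ).toAddMonoidHom) (mulHom H x y) =
        mulHom K (lift ((ofClass K).comp (BurnsideSemiring.res φ).toAddMonoidHom) x)
          (lift ((ofClass K).comp (BurnsideSemiring.res φ).toAddMonoidHom) y)
      obtain ⟨a, a', rfl⟩ := exists_sub x
      obtain ⟨b, b', rfl⟩ := exists_sub y
      simp [lift_ofClass, mulHom_ofClass] }

/-- Transfer along `φ : K →* H`: the additive map sending the class of a `K`-set `X` to the class of
`H ×_K X`. -/
noncomputable def tr {K H : Type u} [Group K] [Group H] [Finite H] (φ : K →* H) :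
    BurnsideRing K →+ BurnsideRing H :=
  lift ((ofClass H).comp (BurnsideSemiring.ind φ))

/-- Norm along `φ : K →* H`: the polynomial extension to the Burnside ring of the map sending a
`K`-set `X` to the class of `Map_K(H, X)`. -/
noncomputable def norm {K H : Type u} [Group K] [Group H] [Finite H] (φ : K →* H)
    (x : BurnsideRing K) : BurnsideRing H :=
  polynomialExtension (Nat.card H) (BurnsideSemiring.coind φ)
    (BurnsideSemiring.isPolynomialMap_coind φ) x

theorem res_of {K H : Type u} [Group K] [Group H] (φ : K →* H) (X : FinGSet H) :
    res φ (of X) = of (FinGSet.res φ X) :=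
  lift_ofClass _ _

theorem tr_of {K H : Type u} [Group K] [Group H] [Finite H] (φ : K →* H) (X : FinGSet K) :
    tr φ (of X) = of (FinGSet.ind φ X) :=
  lift_ofClass _ _

theorem norm_of {K H : Type u} [Group K] [Group H] [Finite H] (φ : K →* H) (X : FinGSet K) :
    norm φ (of X) = of (FinGSet.coind φ X) :=
  polynomialExtension_of _ _ _ _

end BurnsideRing

/-! ## Ideals of the Burnside Tambara functor

The Burnside Tambara functor of `G` has the value `BurnsideRing H` at `G/H`. -/

namespace BurnsideTambara

/-- Restriction from `H` to `K ≤ H`. -/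
noncomputable def res {G : Type u} [Group G] {K H : Subgroup G} (h : K ≤ H) :
    BurnsideRing H →+* BurnsideRing K :=
  BurnsideRing.res (Subgroup.inclusion h)

/-- Transfer from `K` to `H ≥ K`. -/
noncomputable def tr {G : Type u} [Group G] [Finite G] {K H : Subgroup G} (h : K ≤ H) :
    BurnsideRing K →+ BurnsideRing H :=
  BurnsideRing.tr (Subgroup.inclusion h)

/-- Norm from `K` to `H ≥ K`. -/
noncomputable def norm {G : Type u} [Group G] [Finite G] {K H : Subgroup G} (h : K ≤ H) :
    BurnsideRing K → BurnsideRing H :=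
  BurnsideRing.norm (Subgroup.inclusion h)

/-- The conjugate subgroup `H^g = g⁻¹ H g`, i.e. the set of all `k` with `g k g⁻¹ ∈ H`. -/
def conjSubgroup {G : Type u} [Group G] (g : G) (H : Subgroup G) : Subgroup G :=
  H.comap (MulAut.conj g).toMonoidHom

/-- Conjugation `X ↦ X^g`: an element `k` of `H^g` acts on `X^g` as `g k g⁻¹ ∈ H` acts on `X`. -/
noncomputable def conj {G : Type u} [Group G] (g : G) (H : Subgroup G) :
    BurnsideRing H →+* BurnsideRing (conjSubgroup g H) :=
  BurnsideRing.res ((MulAut.conj g).toMonoidHom.subgroupComap H)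

/-- A choice of an ideal of the ring `BurnsideRing H` for every subgroup `H` of `G`. -/
abbrev IdealFamily (G : Type u) [Group G] : Type (u + 1) :=
  ∀ H : Subgroup G, Ideal (BurnsideRing H)

/-- Ideals of the Burnside Tambara functor: families of ideals compatible with restrictions,
transfers, norms and conjugations. -/
structure IsTambaraIdeal {G : Type u} [Group G] [Finite G] (P : IdealFamily G) : Prop where
  res_mem : ∀ {K H : Subgroup G} (h : K ≤ H), ∀ x ∈ P H, res h x ∈ P K
  tr_mem : ∀ {K H : Subgroup G} (h : K ≤ H), ∀ x ∈ P K, tr h x ∈ P H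
  norm_mem : ∀ {K H : Subgroup G} (h : K ≤ H), ∀ x ∈ P K, ∃ y ∈ P H, norm h x = y + norm h 0
  conj_mem : ∀ (g : G) (H : Subgroup G), ∀ x ∈ P H, conj g H x ∈ P (conjSubgroup g H)

/-- The value at `G/H` of the product of `I` and `J`: all elements `f_+(ab)` for a map of finite
`G`-sets `f : A → G/H`, `a ∈ I(A)` and `b ∈ J(A)`. Decomposing `A` into orbits `G/K`, the map `f` is
given on each of them by some `g` with `K^g ≤ H`, as the composite of the isomorphism
`G/K ≅ G/K^g` and the projection `G/K^g → G/H`, so `f_+(ab)` is the sum of the corresponding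
`tr (c_g (ab))`. -/
noncomputable def productAt {G : Type u} [Group G] [Finite G] (I J : IdealFamily G)
    (H : Subgroup G) : AddSubmonoid (BurnsideRing H) :=
  AddSubmonoid.closure
    {x | ∃ (K : Subgroup G) (g : G) (h : conjSubgroup g K ≤ H), ∃ a ∈ I K, ∃ b ∈ J K,
      x = tr h (conj g K (a * b))}

/-- Prime ideals of the Burnside Tambara functor: proper ideals `P` such that `I J ⊆ P` implies
`I ⊆ P` or `J ⊆ P` for all ideals `I` and `J`. -/
structure IsPrimeTambaraIdeal {G : Type u} [Group G] [Finite G] (P : IdealFamily G) : Prop where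
  isTambaraIdeal : IsTambaraIdeal P
  proper : ∃ H, P H ≠ ⊤
  prime : ∀ I J : IdealFamily G, IsTambaraIdeal I → IsTambaraIdeal J →
    (∀ H, ∀ x ∈ productAt I J H, x ∈ P H) → (∀ H, I H ≤ P H) ∨ (∀ H, J H ≤ P H)

/-- The restriction of a family of ideals to a subgroup `I` of `G`: its value at `H ≤ I` is that of
`P` at `H` regarded as a subgroup of `G`, the two Burnside rings being identified through the
isomorphism of `H` with its image in `G`. -/
noncomputable def restrict {G : Type u} [Group G] (P : IdealFamily G) (I : Subgroup G) :
    IdealFamily I :=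
  fun H => (P (H.map I.subtype)).comap
    (BurnsideRing.res (H.equivMapOfInjective I.subtype I.subtype_injective).symm.toMonoidHom)

end BurnsideTambara

/-! The proof classifies the prime ideals for abelian $G$. For $x\in A(K)$ and $L\le G$, the mark of
$x$ at $L$ is the ring homomorphism counting points fixed by $L\cap K$. Marks jointly determine $x$
(`eq_zero_of_mark_eq_zero`). Since $G$ is abelian, they interact simply with the structure maps:
restriction to $K$ replaces $L$ by $L\cap K$, conjugation changes nothing, a transfer multiplies a
mark by an integer (`mark_tr`), and a norm raises it to a positive power (`mark_norm`).

For $H\le G$ and a prime ideal $q$ of $\mathbb{Z}$, let $P_{H,q}$ consist of the elements whose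
marks at all $L\le H$ lie in $q$; this is `markIdeal (idealOn (Set.Iic H) q)`. Each $P_{H,q}$ is
prime (`isPrimeTambaraIdeal_markIdeal`), and each prime ideal is some $P_{H,q}$
(`exists_eq_markIdeal`). Its restriction to $I$ is $P_{H\cap I,q}$ (`restrict_markIdeal`), because
the groups $L\cap I$ with $L\le H$ are exactly the subgroups of $H\cap I$. The theorem follows.

For the classification, $q$ is a largest ideal of $\mathbb{Z}$ such that $P$ contains all elements
with every mark in $q$, and $H$ is a maximal member of a smallest lower set of subgroups on which
the condition "marks in $q$" still forces membership in $P$. This gives $P_{H,q}\subseteq P$. An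
element of $P$ outside $P_{H,q}$ could be restricted and normed to an element of $P(H)$ whose mark
at $H$ is not in $q$; correcting by multiples of its norms then contradicts the choice of $q$ and
$H$. -/

/-! ## Marks -/

namespace BurnsideSemiring

/-- The number of points of a finite `G`-set that are fixed by a subgroup. -/
noncomputable def fixedCount {G : Type u} [Group G] (S : Subgroup G) :
    BurnsideSemiring G →+* ℤ where
  toFun := Quotient.lift (fun X : FinGSet G => (Nat.card {x : X.carrier // ∀ s ∈ S, s • x = x} : ℤ))
    (by
      rintro X Y ⟨e, he⟩
      refine congrArg Nat.cast (Nat.card_congr (e.subtypeEquiv fun x => ?_))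
      simp only [← he, e.apply_eq_iff_eq])
  map_one' := by
    change ((Nat.card {x : PUnit // ∀ s ∈ S, s • x = x} : ℕ) : ℤ) = 1
    rw [Nat.cast_eq_one, Nat.card_eq_one_iff_unique]
    exact ⟨inferInstance, ⟨⟨PUnit.unit, fun _ _ => rfl⟩⟩⟩
  map_zero' := by
    change ((Nat.card {x : PEmpty // _} : ℕ) : ℤ) = 0
    simp
  map_add' := by
    rintro ⟨X⟩ ⟨Y⟩
    change ((Nat.card {z : X.carrier ⊕ Y.carrier // ∀ s ∈ S, s • z = z} : ℕ) : ℤ) =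
      (Nat.card {x : X.carrier // ∀ s ∈ S, s • x = x} : ℤ) +
        (Nat.card {y : Y.carrier // ∀ s ∈ S, s • y = y} : ℤ)
    rw [← Nat.cast_add, ← Nat.card_sum, Nat.card_congr Equiv.subtypeSum]
    simp only [Sum.smul_inl, Sum.smul_inr, Sum.inl.injEq, Sum.inr.injEq]
  map_mul' := by
    rintro ⟨X⟩ ⟨Y⟩
    change ((Nat.card {z : X.carrier × Y.carrier // ∀ s ∈ S, s • z = z} : ℕ) : ℤ) =
      (Nat.card {x : X.carrier // ∀ s ∈ S, s • x = x} : ℤ) *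
        (Nat.card {y : Y.carrier // ∀ s ∈ S, s • y = y} : ℤ)
    rw [← Nat.cast_mul, ← Nat.card_prod]
    refine congrArg Nat.cast (Nat.card_congr ((Equiv.subtypeEquivRight fun z => ?_).trans
      Equiv.subtypeProdEquivProd))
    simp only [Prod.ext_iff, Prod.smul_fst, Prod.smul_snd]
    exact ⟨fun h => ⟨fun s hs => (h s hs).1, fun s hs => (h s hs).2⟩,
      fun h s hs => ⟨h.1 s hs, h.2 s hs⟩⟩

end BurnsideSemiring

namespace BurnsideRing

theorem ofClass_mul {G : Type u} [Group G] (x y : BurnsideSemiring G) :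
    ofClass G x * ofClass G y = ofClass G (x * y) :=
  mulHom_ofClass x y

/-- The mark homomorphism, counting the points fixed by a subgroup. -/
noncomputable def mark {G : Type u} [Group G] (S : Subgroup G) : BurnsideRing G →+* ℤ :=
  { lift (BurnsideSemiring.fixedCount S).toAddMonoidHom with
    map_one' := by
      change lift _ (ofClass G 1) = 1
      rw [lift_ofClass]
      exact map_one (BurnsideSemiring.fixedCount S)
    map_mul' := fun x y => by
      change lift (BurnsideSemiring.fixedCount S).toAddMonoidHom (x * y) =
        lift (BurnsideSemiring.fixedCount S).toAddMonoidHom x *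
          lift (BurnsideSemiring.fixedCount S).toAddMonoidHom y
      obtain ⟨a, a', rfl⟩ := exists_sub x
      obtain ⟨b, b', rfl⟩ := exists_sub y
      simp only [sub_mul, mul_sub, ofClass_mul, map_sub, lift_ofClass, RingHom.toAddMonoidHom_eq_coe,
        AddMonoidHom.coe_coe, map_mul] }

theorem mark_ofClass {G : Type u} [Group G] (S : Subgroup G) (x : BurnsideSemiring G) :
    mark S (ofClass G x) = BurnsideSemiring.fixedCount S x :=
  lift_ofClass _ _

theorem mark_of {G : Type u} [Group G] (S : Subgroup G) (X : FinGSet G) :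
    mark S (of X) = Nat.card {x : X.carrier // ∀ s ∈ S, s • x = x} :=
  mark_ofClass S _

theorem hom_ext_of {G : Type u} [Group G] {B : Type*} [AddCommGroup B] {f g : BurnsideRing G →+ B}
    (h : ∀ X : FinGSet G, f (of X) = g (of X)) : f = g :=
  hom_ext (by rintro ⟨X⟩; exact h X)

theorem mark_res {K H : Type u} [Group K] [Group H] (φ : K →* H) (S : Subgroup K)
    (x : BurnsideRing H) : mark S (res φ x) = mark (S.map φ) x := by
  have h : (mark S).toAddMonoidHom.comp (res φ).toAddMonoidHom = (mark (S.map φ)).toAddMonoidHom := by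
    refine hom_ext_of fun X => ?_
    change mark S (res φ (of X)) = mark (S.map φ) (of X)
    rw [res_of, mark_of, mark_of]
    refine congrArg Nat.cast (Nat.card_congr (Equiv.subtypeEquivRight fun x => ?_))
    constructor
    · rintro h _ ⟨s, hs, rfl⟩
      exact h s hs
    · exact fun h s hs => h _ ⟨s, hs, rfl⟩
  exact DFunLike.congr_fun h x

-- As $H$ is commutative, $s$ fixes the class of $(h,x)$ exactly when $s=\varphi(l)$ for some $l$
-- fixing $x$. Hence a fixed point is a coset of the image of $\varphi$ together with a fixed point
-- of $X$, and there are none unless $S$ lies in that image.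
open Classical in
theorem mark_tr {K H : Type u} [CommGroup K] [CommGroup H] [Finite H] {φ : K →* H}
    (hφ : Function.Injective φ) (S : Subgroup H) (x : BurnsideRing K) :
    mark S (tr φ x) = if S ≤ φ.range then φ.range.index * mark (S.comap φ) x else 0 := by
  let c : ℤ := if S ≤ φ.range then φ.range.index else 0
  have h : (mark S).toAddMonoidHom.comp (tr φ) = c • (mark (S.comap φ)).toAddMonoidHom := by
    refine hom_ext_of fun X => ?_
    change mark S (tr φ (of X)) = c * mark (S.comap φ) (of X)
    rw [tr_of, mark_of, mark_of]
    by_cases hS : S ≤ φ.range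
    · simp only [c, if_pos hS, Subgroup.index]
      rw [← Nat.cast_mul, ← Nat.card_prod]
      refine congrArg Nat.cast (Nat.card_congr (Equiv.symm (Equiv.ofBijective
        (fun p => ⟨Quotient.mk (FinGSet.indSetoid φ X) (p.1.out, p.2.1), ?_⟩) ⟨?_, ?_⟩)))
      · intro s hs
        obtain ⟨k, rfl⟩ := hS hs
        have hk : k • p.2.1 = p.2.1 := p.2.2 k hs
        refine Quotient.sound ⟨k, Prod.ext ?_ hk.symm⟩
        change p.1.out = φ k * p.1.out * (φ k)⁻¹
        rw [mul_comm (φ k), mul_inv_cancel_right]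
      · rintro ⟨a, x, hx⟩ ⟨b, y, hy⟩ h
        obtain ⟨k, hk⟩ := Quotient.exact (congrArg Subtype.val h)
        have h1 : b.out = a.out * (φ k)⁻¹ := congrArg Prod.fst hk
        have h2 : y = k • x := congrArg Prod.snd hk
        have hab : a = b := by
          rw [← QuotientGroup.out_eq' a, ← QuotientGroup.out_eq' b, QuotientGroup.eq, h1]
          exact ⟨k⁻¹, by simp⟩
        subst hab
        have hk1 : k = 1 := by
          apply hφ
          simpa using h1
        subst hk1
        simp only [one_smul] at h2
        subst h2
        rfl
      · rintro ⟨⟨⟨h, x⟩⟩, hx⟩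
        obtain ⟨k, hk⟩ : ∃ k : K, (QuotientGroup.mk h : H ⧸ φ.range).out = h * (φ k)⁻¹ := by
          obtain ⟨⟨_, k, rfl⟩, hk⟩ := QuotientGroup.mk_out_eq_mul φ.range h
          exact ⟨k⁻¹, by simpa using hk⟩
        have hx' : ∀ s ∈ S.comap φ, s • (k • x) = k • x := by
          intro s hs
          obtain ⟨l, hl⟩ := Quotient.exact (hx (φ s) hs)
          have h1 : h = φ s * h * (φ l)⁻¹ := congrArg Prod.fst hl
          have h2 : x = l • x := congrArg Prod.snd hl
          have : s = l := by
            apply hφ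
            rw [mul_comm (φ s), mul_assoc] at h1
            simpa [mul_inv_eq_one] using h1
          subst this
          rw [smul_smul, mul_comm, ← smul_smul, ← h2]
        exact ⟨⟨QuotientGroup.mk h, k • x, hx'⟩, Subtype.ext (Eq.symm
          (Quotient.sound (a := (h, x)) ⟨k, Prod.ext hk rfl⟩))⟩
    · simp only [c, if_neg hS, zero_mul]
      rw [Nat.cast_eq_zero]
      have : IsEmpty {x : (FinGSet.ind φ X).carrier // ∀ s ∈ S, s • x = x} := by
        refine ⟨?_⟩
        rintro ⟨⟨⟨h, x⟩⟩, hx⟩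
        refine hS fun s hs => ?_
        obtain ⟨l, hl⟩ := Quotient.exact (hx s hs)
        have h1 : h = s * h * (φ l)⁻¹ := congrArg Prod.fst hl
        refine ⟨l, ?_⟩
        rw [mul_comm s, mul_assoc] at h1
        exact (mul_inv_eq_one.1 (by simpa using h1)).symm
      exact Nat.card_of_isEmpty
  have := DFunLike.congr_fun h x
  change mark S (tr φ x) = c * mark (S.comap φ) x at this
  rw [this, ite_mul, zero_mul]

end BurnsideRing

/-! ## Marks of norms -/

theorem newtonValue_comp_left {M B C : Type*} [AddCommMonoid M] [AddCommGroup B] [AddCommGroup C]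
    (n : ℕ) (θ : B →+ C) (f : M → B) (x y : M) :
    newtonValue n (fun z => θ (f z)) x y = θ (newtonValue n f x y) := by
  simp only [newtonValue, fwdDiff_iter_eq_sum_shift, map_sum, map_zsmul]

theorem newtonValue_comp_right {M N B : Type*} [AddCommMonoid M] [AddCommMonoid N]
    [AddCommGroup B] (n : ℕ) (ψ : M →+ N) (f : N → B) (x y : M) :
    newtonValue n (fun z => f (ψ z)) x y = newtonValue n f (ψ x) (ψ y) := by
  simp only [newtonValue, fwdDiff_iter_eq_sum_shift, map_add, map_nsmul]

theorem newtonValue_zero_right {M B : Type*} [AddCommMonoid M] [AddCommGroup B]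
    (n : ℕ) (f : M → B) (x : M) : newtonValue n f x 0 = f x := by
  rw [newtonValue, Finset.sum_range_succ', Finset.sum_eq_zero]
  · simp
  · intro j _
    rw [Function.iterate_succ_apply]
    have h : fwdDiff (0 : M) f = 0 := by
      funext w
      simp [fwdDiff]
    rw [h, fwdDiff_iter_eq_sum_shift]
    simp

theorem isPolynomialMap_pow {R : Type*} [CommRing R] {m n : ℕ} (h : m ≤ n) :
    IsPolynomialMap n (fun r : R => r ^ m) := by
  intro y
  funext x
  -- Along the line $t\mapsto x+ty$ the power map is a polynomial in $t$ of degree at most $m$, so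
  -- its differences of order $n+1$ with step 1 vanish.
  let p : Polynomial R := (Polynomial.C x + Polynomial.C y * Polynomial.X) ^ m
  have hp : p.natDegree < n + 1 := by
    refine Nat.lt_succ_of_le (le_trans Polynomial.natDegree_pow_le ?_)
    have : (Polynomial.C x + Polynomial.C y * Polynomial.X).natDegree ≤ 1 := by compute_degree
    exact le_trans (Nat.mul_le_mul_left m this) (by omega)
  have h0 := congrFun (Polynomial.fwdDiff_iter_eq_zero_of_degree_lt hp) 0
  rw [fwdDiff_iter_eq_sum_shift] at h0 ⊢
  refine Eq.trans (Finset.sum_congr rfl fun k _ => ?_) h0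
  have hev : ∀ t, p.eval t = (x + y * t) ^ m := fun t => by simp [p]
  rw [hev]
  simp only [zero_add, nsmul_eq_mul, mul_one, mul_comm y]

theorem newtonValue_pow {R : Type*} [CommRing R] {m n : ℕ} (h : m ≤ n) (x y : R) :
    newtonValue n (fun r : R => r ^ m) x y = (x - y) ^ m := by
  -- In a ring both arguments may be shifted by $-y$, which makes the second one zero.
  rw [← newtonValue_add_add (isPolynomialMap_pow h) x y (-y), add_neg_cancel,
    newtonValue_zero_right, sub_eq_add_neg]

namespace BurnsideRing

/-- An $S$-fixed element of $\mathrm{Map}_K(H,X)$ is a $K$-equivariant function invariant under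
translation by $S$. It is given by its values at representatives of the cosets of $\varphi(K)S$;
these are independent, each subject only to being fixed by $\varphi^{-1}(S)$. -/
theorem mark_of_coind {K H : Type u} [CommGroup K] [CommGroup H] [Finite H] (φ : K →* H)
    (S : Subgroup H) (X : FinGSet K) :
    mark S (of (FinGSet.coind φ X)) = mark (S.comap φ) (of X) ^ (φ.range ⊔ S).index := by
  rw [mark_of, mark_of, ← Nat.cast_pow, Subgroup.index, ← Nat.card_fun]
  have hfix : ∀ f : {f : (FinGSet.coind φ X).carrier // ∀ s ∈ S, s • f = f}, ∀ s ∈ S, ∀ h,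
      f.1.1 (h * s) = f.1.1 h := fun f s hs h => congrFun (congrArg Subtype.val (f.2 s hs)) h
  have hdec : ∀ h : H, ∃ (k : K) (s : H), s ∈ S ∧
      h = φ k * (QuotientGroup.mk h : H ⧸ (φ.range ⊔ S)).out * s := by
    intro h
    obtain ⟨⟨n, hn⟩, hh⟩ := QuotientGroup.mk_out_eq_mul (φ.range ⊔ S) h
    obtain ⟨_, ⟨k, rfl⟩, s, hs, hks⟩ := Subgroup.mem_sup.1 (inv_mem hn)
    refine ⟨k, s, hs, ?_⟩
    rw [hh, mul_comm (φ k), mul_assoc, hks]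
    simp
  refine congrArg Nat.cast (Nat.card_congr (Equiv.ofBijective
    (fun f q => ⟨f.1.1 q.out, ?_⟩) ⟨?_, ?_⟩))
  · intro k hk
    rw [← f.1.2, mul_comm, hfix f _ hk]
  · intro f g hfg
    refine Subtype.ext (Subtype.ext (funext fun h => ?_))
    obtain ⟨k, s, hs, hh⟩ := hdec h
    rw [hh, hfix f s hs, hfix g s hs, f.1.2, g.1.2]
    exact congrArg (k • ·) (congrArg Subtype.val (congrFun hfg (QuotientGroup.mk h)))
  · intro F
    choose k s hs hh using hdec
    -- The value prescribed at $h=\varphi(a)\,q\,t$ does not depend on the decomposition: two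
    -- choices of $a$ differ by an element of $\varphi^{-1}(S)$, which fixes the value of `F` at
    -- $q$.
    have key : ∀ (a : K) (t : H), t ∈ S → ∀ (h : H) (q : H ⧸ (φ.range ⊔ S)),
        h = φ a * q.out * t → k h • (F (QuotientGroup.mk h)).1 = a • (F q).1 := by
      intro a t ht h q hq
      have hmk : QuotientGroup.mk h = q := by
        rw [← QuotientGroup.out_eq' q, eq_comm, QuotientGroup.eq, hq]
        have h1 : q.out⁻¹ * (φ a * q.out * t) = φ a * t := by
          rw [mul_comm (φ a), mul_assoc, inv_mul_cancel_left]
        rw [h1]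
        exact mul_mem (Subgroup.mem_sup_left ⟨a, rfl⟩) (Subgroup.mem_sup_right ht)
      have h2 := hh h
      rw [hmk] at h2
      have h5 : φ a * t = φ (k h) * s h := by
        apply mul_right_cancel (b := q.out)
        rw [mul_right_comm, ← hq, mul_right_comm, ← h2]
      have h3 : a⁻¹ * k h ∈ S.comap φ := by
        change φ (a⁻¹ * k h) ∈ S
        have h6 : φ (a⁻¹ * k h) = t * (s h)⁻¹ := by
          rw [map_mul, map_inv, inv_mul_eq_iff_eq_mul, ← mul_assoc, h5, mul_inv_cancel_right]
        rw [h6]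
        exact mul_mem ht (inv_mem (hs h))
      rw [hmk]
      have h4 := (F q).2 _ h3
      rw [mul_smul] at h4
      rw [← h4, smul_inv_smul, h4]
    refine ⟨⟨⟨fun h => k h • (F (QuotientGroup.mk h)).1, fun a h => ?_⟩, fun t ht => ?_⟩, ?_⟩
    · rw [← mul_smul]
      refine key (a * k h) (s h) (hs h) _ _ ?_
      rw [map_mul, mul_assoc, mul_assoc, ← mul_assoc (φ (k h)), ← hh]
    · refine Subtype.ext (funext fun h => ?_)
      refine key (k h) (s h * t) (mul_mem (hs h) ht) (h * t) _ ?_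
      rw [← mul_assoc, ← hh]
    · funext q
      refine Subtype.ext ?_
      change k q.out • (F (QuotientGroup.mk q.out)).1 = (F q).1
      rw [key 1 1 (one_mem S) q.out q (by simp), one_smul]

/-- On classes of sets this is `mark_of_coind`. It passes to differences because the Newton
expansion commutes with additive maps on either side and computes $r\mapsto r^m$ correctly for
$m\le|H|$; the index qualifies since it divides $|H|$. -/
theorem mark_norm {K H : Type u} [CommGroup K] [CommGroup H] [Finite H] (φ : K →* H)
    (S : Subgroup H) (x : BurnsideRing K) :
    mark S (norm φ x) = mark (S.comap φ) x ^ (φ.range ⊔ S).index := by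
  obtain ⟨a, b, rfl⟩ := exists_sub x
  have h1 : norm φ (ofClass K a - ofClass K b) =
      newtonValue (Nat.card H) (BurnsideSemiring.coind φ) a b :=
    polynomialExtension_sub _ _ _ _ _
  have h2 : (fun z => (mark S).toAddMonoidHom (BurnsideSemiring.coind φ z)) = fun z =>
      (fun r : ℤ => r ^ (φ.range ⊔ S).index)
        (((mark (S.comap φ)).toAddMonoidHom.comp (ofClass K)) z) := by
    funext z
    obtain ⟨X⟩ := z
    exact mark_of_coind φ S X
  have h3 := newtonValue_comp_left (Nat.card H) (mark S).toAddMonoidHom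
    (BurnsideSemiring.coind φ) a b
  have h4 := newtonValue_comp_right (Nat.card H)
    ((mark (S.comap φ)).toAddMonoidHom.comp (ofClass K))
    (fun r : ℤ => r ^ (φ.range ⊔ S).index) a b
  rw [newtonValue_pow (Nat.le_of_dvd Nat.card_pos (Subgroup.index_dvd_card _))] at h4
  rw [h1, map_sub]
  exact (h3.symm.trans (congrArg (fun f => newtonValue (Nat.card H) f a b) h2)).trans h4

end BurnsideRing

/-! ## Marks detect elements of the Burnside ring -/

namespace FinGSet

/-- The transitive `G`-set `G/S`. -/
def quot {G : Type u} [Group G] [Finite G] (S : Subgroup G) : FinGSet G where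
  carrier := G ⧸ S

/-- The complement of an orbit. -/
def orbitCompl {G : Type u} [Group G] (X : FinGSet G) (x : X.carrier) : FinGSet G where
  carrier := {y : X.carrier // y ∉ MulAction.orbit G x}
  action :=
    { smul := fun g y => ⟨g • y.1, fun h => y.2 (by
        have := MulAction.mem_orbit_of_mem_orbit g⁻¹ h
        rwa [inv_smul_smul] at this)⟩
      one_smul := fun y => Subtype.ext (one_smul G y.1)
      mul_smul := fun a b y => Subtype.ext (mul_smul a b y.1) }

theorem quot_sum_orbitCompl {G : Type u} [Group G] [Finite G] (X : FinGSet G) (x : X.carrier) :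
    (quot (MulAction.stabilizer G x)).sum (orbitCompl X x) ≈ X := by
  refine ⟨Equiv.ofBijective
    (Sum.elim (MulAction.ofQuotientStabilizer G x) Subtype.val) ⟨?_, ?_⟩, ?_⟩
  · refine (MulAction.injective_ofQuotientStabilizer G x).sumElim Subtype.val_injective ?_
    intro q y h
    exact y.2 (h ▸ MulAction.ofQuotientStabilizer_mem_orbit G x q)
  · intro y
    by_cases hy : y ∈ MulAction.orbit G x
    · obtain ⟨g, rfl⟩ := hy
      exact ⟨Sum.inl (QuotientGroup.mk g), MulAction.ofQuotientStabilizer_mk G x g⟩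
    · exact ⟨Sum.inr ⟨y, hy⟩, rfl⟩
  · rintro g (q | y)
    · exact MulAction.ofQuotientStabilizer_smul G x g q
    · rfl

end FinGSet

namespace BurnsideRing

theorem of_congr {G : Type u} [Group G] {X Y : FinGSet G} (h : X ≈ Y) : of X = of Y :=
  congrArg (ofClass G) (Quotient.sound h)

theorem of_sum {G : Type u} [Group G] (X Y : FinGSet G) : of (X.sum Y) = of X + of Y :=
  map_add (ofClass G) (BurnsideSemiring.mk X) (BurnsideSemiring.mk Y)

theorem of_mem_span_quot {G : Type u} [Group G] [Finite G] (X : FinGSet G) :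
    of X ∈ Submodule.span ℤ (Set.range fun S : Subgroup G => of (FinGSet.quot S)) := by
  induction hn : Nat.card X.carrier using Nat.strong_induction_on generalizing X with
  | _ n ih =>
    rcases isEmpty_or_nonempty X.carrier with h | ⟨⟨x⟩⟩
    · have h0 : of X = 0 := (of_congr ⟨Equiv.equivPEmpty _, fun a f => isEmptyElim f⟩ :
        of X = of (FinGSet.empty G)).trans (map_zero (ofClass G))
      rw [h0]
      exact zero_mem _
    · rw [← of_congr (FinGSet.quot_sum_orbitCompl X x), of_sum]
      refine add_mem (Submodule.subset_span ⟨_, rfl⟩) (ih _ ?_ _ rfl)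
      rw [← hn]
      exact Finite.card_subtype_lt (x := x) (fun h => h (MulAction.mem_orbit_self x))

theorem mem_span_quot {G : Type u} [Group G] [Finite G] (x : BurnsideRing G) :
    x ∈ Submodule.span ℤ (Set.range fun S : Subgroup G => of (FinGSet.quot S)) := by
  obtain ⟨⟨X⟩, ⟨Y⟩, rfl⟩ := exists_sub x
  exact sub_mem (of_mem_span_quot X) (of_mem_span_quot Y)

theorem mark_quot_self {G : Type u} [CommGroup G] [Finite G] (S : Subgroup G) :
    mark S (of (FinGSet.quot S)) ≠ 0 := by
  rw [mark_of, Nat.cast_ne_zero]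
  have : Nonempty {x : G ⧸ S // ∀ s ∈ S, s • x = x} := by
    refine ⟨⟨QuotientGroup.mk 1, fun s hs => ?_⟩⟩
    change (QuotientGroup.mk (s * 1) : G ⧸ S) = QuotientGroup.mk 1
    rw [QuotientGroup.eq]
    simpa using hs
  exact (Nat.card_pos (α := {x : G ⧸ S // ∀ s ∈ S, s • x = x})).ne'

theorem mark_quot_of_not_le {G : Type u} [CommGroup G] [Finite G] {S L : Subgroup G}
    (h : ¬ S ≤ L) : mark S (of (FinGSet.quot L)) = 0 := by
  rw [mark_of, Nat.cast_eq_zero]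
  have : IsEmpty {x : G ⧸ L // ∀ s ∈ S, s • x = x} := by
    refine ⟨?_⟩
    rintro ⟨⟨x⟩, hx⟩
    refine h fun s hs => ?_
    have h1 : (QuotientGroup.mk (s * x) : G ⧸ L) = QuotientGroup.mk x := hx s hs
    rw [eq_comm, QuotientGroup.eq, mul_comm s, inv_mul_cancel_left] at h1
    exact h1
  exact Nat.card_of_isEmpty (α := {x : G ⧸ L // ∀ s ∈ S, s • x = x})

/-- The table of marks is triangular: the orbits $G/L$ span the Burnside ring, and the mark of $G/L$
at $S$ vanishes unless $S\le L$ and is nonzero for $S=L$. -/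
theorem eq_zero_of_mark_eq_zero {G : Type u} [CommGroup G] [Finite G] {x : BurnsideRing G}
    (hx : ∀ S, mark S x = 0) : x = 0 := by
  classical
  have := Fintype.ofFinite (Subgroup G)
  obtain ⟨c, rfl⟩ := (Submodule.mem_span_range_iff_exists_fun ℤ).1 (mem_span_quot x)
  by_cases hc : ∀ S, c S = 0
  · simp [hc]
  · push Not at hc
    -- For $S$ maximal in the support of `c`, the mark at $S$ sees only the term of $G/S$.
    obtain ⟨S, hS, hmax⟩ := Set.Finite.exists_maximal (Set.toFinite {S | c S ≠ 0}) hc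
    have h := hx S
    rw [map_sum, Finset.sum_eq_single S] at h
    · rw [map_zsmul, smul_eq_mul, mul_eq_zero] at h
      exact absurd (h.resolve_right (mark_quot_self S)) hS
    · intro L _ hL
      rw [map_zsmul, smul_eq_mul]
      by_cases hSL : S ≤ L
      · have : c L = 0 := by
          by_contra hcL
          exact hL (le_antisymm (hmax hcL hSL) hSL)
        rw [this, zero_mul]
      · rw [mark_quot_of_not_le hSL, mul_zero]
    · exact fun h => absurd (Finset.mem_univ S) h

end BurnsideRing

/-! ## Ideals of the Burnside Tambara functor defined by congruences between marks -/

namespace BurnsideTambara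

open BurnsideRing (mark)

/-- The mark of an element of the Burnside ring of `K` at the subgroup `L ⊓ K`. -/
noncomputable def markAt {G : Type u} [Group G] (L K : Subgroup G) : BurnsideRing K →+* ℤ :=
  mark (L.subgroupOf K)

theorem markAt_inf {G : Type u} [Group G] (L K : Subgroup G) : markAt (L ⊓ K) K = markAt L K := by
  rw [markAt, Subgroup.inf_subgroupOf_right, markAt]

theorem markAt_res {G : Type u} [Group G] {K H : Subgroup G} (h : K ≤ H) (L : Subgroup G)
    (x : BurnsideRing H) : markAt L K (res h x) = markAt (L ⊓ K) H x := by
  have hmap : (L.subgroupOf K).map (Subgroup.inclusion h) = (L ⊓ K).subgroupOf H := by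
    ext ⟨a, ha⟩
    constructor
    · rintro ⟨⟨b, hb⟩, hbL, hab⟩
      obtain rfl : b = a := congrArg Subtype.val hab
      exact ⟨hbL, hb⟩
    · rintro ⟨haL, haK⟩
      exact ⟨⟨a, haK⟩, haL, rfl⟩
  rw [markAt, res, BurnsideRing.mark_res, hmap, markAt]

theorem comap_inclusion_subgroupOf {G : Type u} [Group G] {K H : Subgroup G} (h : K ≤ H)
    (L : Subgroup G) : (L.subgroupOf H).comap (Subgroup.inclusion h) = L.subgroupOf K := rfl

section CommGroup

variable {G : Type u} [CommGroup G]

theorem markAt_conj (g : G) (K L : Subgroup G) (x : BurnsideRing K) :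
    markAt L (conjSubgroup g K) (conj g K x) = markAt L K x := by
  have hmap : (L.subgroupOf (conjSubgroup g K)).map
      ((MulAut.conj g).toMonoidHom.subgroupComap K) = L.subgroupOf K := by
    have hg : ∀ a : G, (MulAut.conj g).toMonoidHom a = a := fun a => by simp
    ext ⟨a, ha⟩
    constructor
    · rintro ⟨⟨b, hb⟩, hbL, hab⟩
      have hab' : (MulAut.conj g).toMonoidHom b = a := congrArg Subtype.val hab
      rw [hg] at hab'
      subst hab'
      exact hbL
    · intro haL
      have haK : a ∈ conjSubgroup g K := by
        change (MulAut.conj g).toMonoidHom a ∈ K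
        rwa [hg]
      exact ⟨⟨a, haK⟩, haL, Subtype.ext (hg a)⟩
  exact (BurnsideRing.mark_res _ _ x).trans (congrArg (fun S => mark S x) hmap)

/-- The elements whose mark at `L` lies in `n L`, for all subgroups `L`. -/
noncomputable def markIdeal (n : Subgroup G → Ideal ℤ) : IdealFamily G :=
  fun K => ⨅ L, (n L).comap (markAt L K)

theorem mem_markIdeal {n : Subgroup G → Ideal ℤ} {K : Subgroup G} {x : BurnsideRing K} :
    x ∈ markIdeal n K ↔ ∀ L, markAt L K x ∈ n L := by
  simp [markIdeal, Submodule.mem_iInf]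

theorem markIdeal_mono {n m : Subgroup G → Ideal ℤ} (h : n ≤ m) : markIdeal n ≤ markIdeal m :=
  fun _ _ hx => mem_markIdeal.2 fun L => h L (mem_markIdeal.1 hx L)

open Classical in
/-- The function with value `q` on `F` and the unit ideal elsewhere. -/
noncomputable def idealOn (F : Set (Subgroup G)) (q : Ideal ℤ) : Subgroup G → Ideal ℤ :=
  fun L => if L ∈ F then q else ⊤

theorem monotone_idealOn {F : Set (Subgroup G)} (hF : IsLowerSet F) (q : Ideal ℤ) :
    Monotone (idealOn F q) := by
  intro L M h
  by_cases hM : M ∈ F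
  · simp [idealOn, hM, hF h hM]
  · simp [idealOn, hM]

theorem mem_markIdeal_idealOn {F : Set (Subgroup G)} {q : Ideal ℤ} {K : Subgroup G}
    {x : BurnsideRing K} : x ∈ markIdeal (idealOn F q) K ↔ ∀ L ∈ F, markAt L K x ∈ q := by
  rw [mem_markIdeal]
  refine forall_congr' fun L => ?_
  by_cases hL : L ∈ F <;> simp [idealOn, hL]

theorem restrict_markIdeal (I H : Subgroup G) (q : Ideal ℤ) :
    restrict (markIdeal (idealOn (Set.Iic H) q)) I =
      markIdeal (idealOn (Set.Iic (H.comap I.subtype)) q) := by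
  funext K
  have hmark : ∀ (L : Subgroup G) (x : BurnsideRing K), markAt L (K.map I.subtype)
      (BurnsideRing.res
        (K.equivMapOfInjective I.subtype I.subtype_injective).symm.toMonoidHom x) =
      markAt (L.comap I.subtype) K x := by
    intro L x
    rw [markAt, BurnsideRing.mark_res, markAt]
    congr 2
    ext a
    constructor
    · rintro ⟨b, hb, rfl⟩
      obtain ⟨a, rfl⟩ := (K.equivMapOfInjective I.subtype I.subtype_injective).surjective b
      change (K.equivMapOfInjective I.subtype I.subtype_injective).symm _ ∈ _
      rw [MulEquiv.symm_apply_apply]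
      exact hb
    · intro ha
      exact ⟨K.equivMapOfInjective I.subtype I.subtype_injective a, ha,
        MulEquiv.symm_apply_apply _ _⟩
  ext x
  rw [restrict, Ideal.mem_comap, mem_markIdeal_idealOn, mem_markIdeal_idealOn]
  simp only [hmark]
  constructor
  · intro h L hL
    -- A subgroup of $I$ is the trace on $I$ of its own image in $G$.
    have := h (L.map I.subtype) (Subgroup.map_le_iff_le_comap.2 hL)
    rwa [Subgroup.comap_map_eq_self_of_injective I.subtype_injective] at this
  · exact fun h L hL => h _ (Subgroup.comap_mono hL)

/-! ### Transfers, norms and ideals in terms of marks -/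

variable [Finite G]

theorem exists_markAt_tr {K H : Subgroup G} (h : K ≤ H) (L : Subgroup G) :
    ∃ c : ℤ, ∀ x, markAt L H (tr h x) = c * markAt L K x := by
  classical
  refine ⟨if L.subgroupOf H ≤ (Subgroup.inclusion h).range then
    ((Subgroup.inclusion h).range.index : ℤ) else 0, fun x => ?_⟩
  rw [markAt, tr, BurnsideRing.mark_tr (Subgroup.inclusion_injective h),
    comap_inclusion_subgroupOf, ite_mul, zero_mul, markAt]

theorem markAt_tr_self {K : Subgroup G} (h : K ≤ K) (L : Subgroup G) (x : BurnsideRing K) :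
    markAt L K (tr h x) = markAt L K x := by
  have hr : (Subgroup.inclusion h).range = ⊤ :=
    MonoidHom.range_eq_top.2 fun a => ⟨a, rfl⟩
  rw [markAt, tr, BurnsideRing.mark_tr (Subgroup.inclusion_injective h),
    comap_inclusion_subgroupOf, hr, if_pos le_top, Subgroup.index_top, Nat.cast_one, one_mul]

theorem exists_markAt_norm {K H : Subgroup G} (h : K ≤ H) (L : Subgroup G) :
    ∃ k : ℕ, k ≠ 0 ∧ k ≤ Nat.card G ∧ ∀ x, markAt L H (norm h x) = markAt L K x ^ k := by
  refine ⟨((Subgroup.inclusion h).range ⊔ L.subgroupOf H).index, Subgroup.index_ne_zero_of_finite,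
    ?_, fun x => ?_⟩
  · exact Nat.le_of_dvd Nat.card_pos
      ((Subgroup.index_dvd_card _).trans (Subgroup.card_subgroup_dvd_card H))
  · rw [markAt, norm, BurnsideRing.mark_norm, comap_inclusion_subgroupOf, markAt]

/-- Monotonicity is what restriction needs, since it replaces $L$ by the smaller $L\cap K$. The norm
needs only that its exponents are positive, so that $N(0)$ has all marks zero. -/
theorem isTambaraIdeal_markIdeal {n : Subgroup G → Ideal ℤ} (hn : Monotone n) :
    IsTambaraIdeal (markIdeal n) where
  res_mem h x hx := mem_markIdeal.2 fun L => by
    rw [markAt_res]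
    exact hn inf_le_left (mem_markIdeal.1 hx _)
  tr_mem h x hx := mem_markIdeal.2 fun L => by
    obtain ⟨c, hc⟩ := exists_markAt_tr h L
    rw [hc]
    exact Ideal.mul_mem_left _ _ (mem_markIdeal.1 hx L)
  norm_mem h x hx := by
    refine ⟨norm h x - norm h 0, mem_markIdeal.2 fun L => ?_, by rw [sub_add_cancel]⟩
    obtain ⟨k, hk, -, hc⟩ := exists_markAt_norm h L
    rw [map_sub, hc, hc, map_zero, zero_pow hk, sub_zero]
    exact Ideal.pow_mem_of_mem _ (mem_markIdeal.1 hx L) _ (Nat.pos_of_ne_zero hk)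
  conj_mem g H x hx := mem_markIdeal.2 fun L => by
    rw [markAt_conj]
    exact mem_markIdeal.1 hx L

/-- The correction term $N(0)$ in the definition of an ideal has zero marks. The uniform bound on
the exponents later allows one integer to serve for all norms at once. -/
theorem IsTambaraIdeal.exists_markAt_eq_pow {P : IdealFamily G} (hP : IsTambaraIdeal P)
    {K H : Subgroup G} (h : K ≤ H) {x : BurnsideRing K} (hx : x ∈ P K) :
    ∃ y ∈ P H, ∀ L, ∃ k : ℕ, k ≠ 0 ∧ k ≤ Nat.card G ∧ markAt L H y = markAt L K x ^ k := by
  obtain ⟨y, hy, hxy⟩ := hP.norm_mem h x hx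
  refine ⟨y, hy, fun L => ?_⟩
  obtain ⟨k, hk, hkG, hc⟩ := exists_markAt_norm h L
  refine ⟨k, hk, hkG, ?_⟩
  rw [← hc x, hxy, map_add, hc, map_zero, zero_pow hk, add_zero]

/-- Restricting to $L\cap K$ and then taking the norm up to $H$ turns the mark at $L$ into a power,
which is the mark at $H$; primality of `q` keeps it outside `q`. -/
theorem IsTambaraIdeal.exists_markAt_self_notMem {P : IdealFamily G} (hP : IsTambaraIdeal P)
    {q : Ideal ℤ} [hq : q.IsPrime] {K L H : Subgroup G} {x : BurnsideRing K} (hx : x ∈ P K)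
    (hL : L ≤ H) (hxL : markAt L K x ∉ q) : ∃ y ∈ P H, markAt H H y ∉ q := by
  have hM : L ⊓ K ≤ H := inf_le_left.trans hL
  obtain ⟨y, hy, hyx⟩ := hP.exists_markAt_eq_pow hM (hP.res_mem inf_le_right x hx)
  refine ⟨y, hy, fun h => hxL ?_⟩
  obtain ⟨k, -, -, hk⟩ := hyx H
  rw [hk, markAt_res, inf_eq_right.2 hM, markAt_inf] at h
  exact hq.mem_of_pow_mem _ h

theorem IsTambaraIdeal.productAt_le {I J P : IdealFamily G} (hP : IsTambaraIdeal P)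
    (h : ∀ K, ∀ a ∈ I K, ∀ b ∈ J K, a * b ∈ P K) : ∀ H, ∀ x ∈ productAt I J H, x ∈ P H := by
  intro H x hx
  have hle : productAt I J H ≤ (P H).toAddSubmonoid := by
    refine AddSubmonoid.closure_le.2 ?_
    rintro _ ⟨K, g, hK, a, ha, b, hb, rfl⟩
    exact hP.tr_mem hK _ (hP.conj_mem g K _ (h K a ha b hb))
  exact hle hx

theorem IsPrimeTambaraIdeal.one_notMem {P : IdealFamily G} (hP : IsPrimeTambaraIdeal P) :
    ∃ K, (1 : BurnsideRing K) ∉ P K :=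
  hP.proper.imp fun _ hK h => hK ((Ideal.eq_top_iff_one _).2 h)

/-- Marks are multiplicative, so the product of the two ideals lies in `markIdeal (n * m)`. All uses
of the primality of `P` in the classification go through this form. -/
theorem IsPrimeTambaraIdeal.markIdeal_le_or {P : IdealFamily G} (hP : IsPrimeTambaraIdeal P)
    {n m : Subgroup G → Ideal ℤ} (hn : Monotone n) (hm : Monotone m)
    (h : markIdeal (n * m) ≤ P) : markIdeal n ≤ P ∨ markIdeal m ≤ P := by
  refine hP.prime _ _ (isTambaraIdeal_markIdeal hn) (isTambaraIdeal_markIdeal hm)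
    (hP.isTambaraIdeal.productAt_le fun _ a ha b hb => h _ (mem_markIdeal.2 fun L => ?_))
  rw [map_mul]
  exact Ideal.mul_mem_mul (mem_markIdeal.1 ha L) (mem_markIdeal.1 hb L)

/-! ## Classification of the prime ideals -/

theorem IsPrimeTambaraIdeal.exists_isPrime {P : IdealFamily G} (hP : IsPrimeTambaraIdeal P) :
    ∃ q : Ideal ℤ, q.IsPrime ∧ markIdeal (fun _ => q) ≤ P ∧
      ∀ n : ℤ, markIdeal (fun _ => Ideal.span {n}) ≤ P → n ∈ q := by
  let A : Set (Ideal ℤ) := {q | markIdeal (fun _ : Subgroup G => q) ≤ P}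
  have hbot : (⊥ : Ideal ℤ) ∈ A := by
    intro K x hx
    have h0 : x = 0 := BurnsideRing.eq_zero_of_mark_eq_zero fun S => by
      have := mem_markIdeal.1 hx (S.map K.subtype)
      rwa [markAt, Subgroup.subgroupOf, Subgroup.comap_map_eq_self_of_injective
        K.subtype_injective, Ideal.mem_bot] at this
    rw [h0]
    exact zero_mem _
  -- `A` contains zero because marks are jointly injective, and $\mathbb{Z}$ is Noetherian.
  obtain ⟨q, hqA, hmax⟩ := exists_maximal_of_wellFoundedGT (· ∈ A) ⟨_, hbot⟩
  have hmono : ∀ I : Ideal ℤ, Monotone fun _ : Subgroup G => I := fun I => monotone_const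
  obtain ⟨K, hK⟩ := hP.one_notMem
  have hprime : q.IsPrime := by
    refine ⟨fun h => ?_, fun {a b} hab => ?_⟩
    · subst h
      exact hK (hqA K (mem_markIdeal.2 fun L => Submodule.mem_top))
    · have hle : (q ⊔ Ideal.span {a}) * (q ⊔ Ideal.span {b}) ≤ q := by
        rw [Ideal.sup_mul, Ideal.mul_sup (Ideal.span {a}), Ideal.span_singleton_mul_span_singleton]
        refine sup_le Ideal.mul_le_left (sup_le Ideal.mul_le_right ?_)
        rwa [Ideal.span_singleton_le_iff_mem]
      refine (hP.markIdeal_le_or (hmono (q ⊔ Ideal.span {a})) (hmono (q ⊔ Ideal.span {b}))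
        ((markIdeal_mono fun _ => hle).trans hqA)).imp (fun h => ?_) fun h => ?_
      · exact hmax h le_sup_left (Ideal.mem_sup_right (Ideal.mem_span_singleton_self a))
      · exact hmax h le_sup_left (Ideal.mem_sup_right (Ideal.mem_span_singleton_self b))
  refine ⟨q, hprime, hqA, fun n hn => ?_⟩
  by_cases hq : q = ⊥
  · exact hmax hn (hq ▸ bot_le) (Ideal.mem_span_singleton_self n)
  -- Here `q` is a maximal ideal, so $an+b=1$ with $b\in q$. The constants $n$ and $b$ both lie in
  -- `P K`, hence so does 1.
  · by_contra hnq
    have hqm := hprime.isMaximal hq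
    obtain ⟨a, b, hb, hab⟩ := hqm.exists_inv hnq
    have h1 : ((n : ℤ) : BurnsideRing K) ∈ P K :=
      hn K (mem_markIdeal.2 fun L => by simp)
    have h2 : ((b : ℤ) : BurnsideRing K) ∈ P K :=
      hqA K (mem_markIdeal.2 fun L => by simpa using hb)
    refine hK ?_
    rw [← Int.cast_one, ← hab, Int.cast_add, Int.cast_mul]
    exact add_mem (Ideal.mul_mem_left _ _ h1) h2

theorem IsPrimeTambaraIdeal.exists_subgroup {P : IdealFamily G} (hP : IsPrimeTambaraIdeal P)
    {q : Ideal ℤ} (hq : markIdeal (fun _ => q) ≤ P) :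
    ∃ H : Subgroup G, markIdeal (idealOn (Set.Iic H) q) ≤ P ∧
      ¬ markIdeal (idealOn (Set.Iio H) q) ≤ P := by
  let A : Set (Set (Subgroup G)) := {F | IsLowerSet F ∧ markIdeal (idealOn F q) ≤ P}
  have hA : A.Nonempty := by
    refine ⟨Set.univ, isLowerSet_univ, fun K x hx => hq K (mem_markIdeal.2 fun L => ?_)⟩
    exact mem_markIdeal_idealOn.1 hx L (Set.mem_univ L)
  obtain ⟨F, ⟨hF, hFP⟩, hmin⟩ := Set.Finite.exists_minimal (Set.toFinite A) hA
  have hne : F.Nonempty := by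
    rw [Set.nonempty_iff_ne_empty]
    rintro rfl
    obtain ⟨K, hK⟩ := hP.one_notMem
    exact hK (hFP K (mem_markIdeal_idealOn.2 fun L hL => hL.elim))
  obtain ⟨H, hHF, hH⟩ := Set.Finite.exists_maximal (Set.toFinite F) hne
  have hIic : Set.Iic H ⊆ F := fun L hL => hF hL hHF
  refine ⟨H, ?_, fun h => ?_⟩
  -- $F$ is the union of the subgroups below $H$ and $F\setminus\{H\}$, so `P` contains the ideal of
  -- one of these two lower sets; minimality of $F$ rules out the second.
  · have hF' : IsLowerSet (F \ {H}) := by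
      rintro L M hML ⟨hL, hLH⟩
      refine ⟨hF hML hL, ?_⟩
      rintro rfl
      exact hLH (le_antisymm (hH hL hML) hML)
    refine (hP.markIdeal_le_or (monotone_idealOn (isLowerSet_Iic H) q) (monotone_idealOn hF' q)
      ((markIdeal_mono fun L => ?_).trans hFP)).resolve_right fun h => ?_
    · by_cases hL : L ∈ F
      · by_cases hLH : L = H
        · subst hLH
          exact Ideal.mul_le_left.trans (by simp [idealOn, hL])
        · exact Ideal.mul_le_right.trans (by simp [idealOn, hL, hLH])
      · simp [idealOn, hL]
    · exact (hmin ⟨hF', h⟩ Set.sdiff_subset hHF).2 rfl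
  · exact lt_irrefl H (hmin ⟨isLowerSet_Iio H, h⟩ (Set.Iio_subset_Iic_self.trans hIic) hHF)

theorem IsPrimeTambaraIdeal.exists_eq_markIdeal {P : IdealFamily G} (hP : IsPrimeTambaraIdeal P) :
    ∃ (H : Subgroup G) (q : Ideal ℤ), q.IsPrime ∧ P = markIdeal (idealOn (Set.Iic H) q) := by
  obtain ⟨q, hq, hqP, hqn⟩ := hP.exists_isPrime
  obtain ⟨H, hH, hH'⟩ := hP.exists_subgroup hqP
  refine ⟨H, q, hq, le_antisymm (fun K x hx => mem_markIdeal_idealOn.2 fun L hL => ?_) hH⟩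
  by_contra hxL
  obtain ⟨y, hy, hyq⟩ := hP.isTambaraIdeal.exists_markAt_self_notMem hx hL hxL
  obtain ⟨K₀, z, hz, hzP⟩ : ∃ K₀, ∃ z ∈ markIdeal (idealOn (Set.Iio H) q) K₀, z ∉ P K₀ := by
    by_contra! h
    exact hH' h
  have hlow := isTambaraIdeal_markIdeal (monotone_idealOn (isLowerSet_Iio H) q)
  -- Otherwise all marks of `z` at subgroups of $H$ would lie in `q`, forcing `z` into `P`.
  have hzq : markAt H K₀ z ∉ q := by
    intro h
    refine hzP (hH K₀ (mem_markIdeal_idealOn.2 fun M hM => ?_))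
    rcases eq_or_lt_of_le (show M ≤ H from hM) with rfl | hM
    · exact h
    · exact mem_markIdeal_idealOn.1 hz M hM
  obtain ⟨w, hw, hwq⟩ := hlow.exists_markAt_self_notMem hz le_rfl hzq
  obtain ⟨c, hc⟩ : ∃ c, markAt H H y = c := ⟨_, rfl⟩
  obtain ⟨d, hd⟩ : ∃ d, markAt H H w = d := ⟨_, rfl⟩
  -- The exponent $|G|$ makes $N$ divisible by $c^id^j$ for all exponents $i,j$ that norms from $H$
  -- can produce. It remains to show that `P` contains all elements with marks in `q` below $H$ and
  -- every mark divisible by $N$ (in the sense of the product ideal): then $N\in q$, a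
  -- contradiction.
  obtain ⟨N, hN⟩ : ∃ N, c ^ Nat.card G * d ^ Nat.card G = N := ⟨_, rfl⟩
  rw [hc] at hyq
  rw [hd] at hwq
  have hNq : N ∉ q := hN ▸ hq.mul_notMem (fun h => hyq (hq.mem_of_pow_mem _ h))
    fun h => hwq (hq.mem_of_pow_mem _ h)
  refine hNq (hqn N ((hP.markIdeal_le_or (monotone_idealOn (isLowerSet_Iio H) q)
    monotone_const fun M v hv => ?_).resolve_left hH'))
  have hvq : ∀ L ∈ Set.Iio H, markAt L M v ∈ q := fun L hL => by
    have := Ideal.mul_le_left (mem_markIdeal.1 hv L)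
    simpa [idealOn, show L < H from hL] using this
  by_cases hHM : H ≤ M
  · obtain ⟨y', hy', hyy⟩ := hP.isTambaraIdeal.exists_markAt_eq_pow hHM hy
    obtain ⟨w', hw', hww⟩ := hlow.exists_markAt_eq_pow hHM hw
    obtain ⟨i, -, hi, hci⟩ := hyy H
    obtain ⟨j, -, hj, hdj⟩ := hww H
    rw [hc] at hci
    rw [hd] at hdj
    have hvN : N ∣ markAt H M v := Ideal.mem_span_singleton.1
      (Ideal.mul_le_right (mem_markIdeal.1 hv H))
    obtain ⟨s, hs⟩ := (mul_dvd_mul (pow_dvd_pow c hi) (pow_dvd_pow d hj)).trans (hN.dvd.trans hvN)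
    -- The multiple of `w' * y'` cancels the mark of `v` at $H$; below $H$ the factor `w'` keeps it
    -- harmless modulo `q`. The factor `y'` puts the subtracted term in `P`.
    have hsub : v - (s : BurnsideRing M) * w' * y' ∈ P M := by
      refine hH M (mem_markIdeal_idealOn.2 fun L hL => ?_)
      rcases eq_or_lt_of_le (show L ≤ H from hL) with rfl | hL
      · have h0 : markAt L M (v - (s : BurnsideRing M) * w' * y') = 0 := by
          rw [map_sub, map_mul, map_mul, map_intCast, hci, hdj, hs, Int.cast_id]
          ring
        rw [h0]
        exact zero_mem q
      · rw [map_sub, map_mul, map_mul]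
        refine sub_mem (hvq L hL) (Ideal.mul_mem_right _ _ (Ideal.mul_mem_left _ _ ?_))
        exact mem_markIdeal_idealOn.1 hw' L hL
    have := add_mem hsub (Ideal.mul_mem_left (P M) ((s : BurnsideRing M) * w') hy')
    rwa [sub_add_cancel] at this
  · refine hH M (mem_markIdeal_idealOn.2 fun L hL => ?_)
    -- If $H\not\le M$, then $L\cap M$ is a proper subgroup of $H$ for each $L\le H$, so the mark at
    -- $H$ itself never enters.
    rw [← markAt_inf]
    refine hvq _ (Set.mem_Iio.2 (lt_of_le_of_ne (inf_le_left.trans hL) fun h => hHM ?_))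
    rw [← h]
    exact inf_le_right

/-! ### Primality of the congruence ideals -/

theorem isPrimeTambaraIdeal_markIdeal (H : Subgroup G) {q : Ideal ℤ} (hq : q.IsPrime) :
    IsPrimeTambaraIdeal (markIdeal (idealOn (Set.Iic H) q)) where
  isTambaraIdeal := isTambaraIdeal_markIdeal (monotone_idealOn (isLowerSet_Iic H) q)
  proper := by
    refine ⟨H, fun h => hq.one_notMem ?_⟩
    have h1 := mem_markIdeal_idealOn.1 ((Ideal.eq_top_iff_one _).1 h) H Set.self_mem_Iic
    rwa [map_one] at h1
  prime I J hI hJ hIJ := by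
    by_contra! h
    obtain ⟨⟨K, hK⟩, M, hM⟩ := h
    -- Any ideal not contained in $P_{H,q}$ is already detected at level $H$ by the single mark at
    -- $H$, where multiplicativity and the primality of `q` suffice.
    have key : ∀ {Q : IdealFamily G}, IsTambaraIdeal Q → ∀ {K},
        ¬ Q K ≤ markIdeal (idealOn (Set.Iic H) q) K → ∃ y ∈ Q H, markAt H H y ∉ q := by
      intro Q hQ K hK
      obtain ⟨x, hx, hxn⟩ := Set.not_subset.1 hK
      have hxn' : ¬ ∀ L ∈ Set.Iic H, markAt L K x ∈ q := fun h => hxn (mem_markIdeal_idealOn.2 h)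
      push Not at hxn'
      obtain ⟨L, hL, hxL⟩ := hxn'
      exact hQ.exists_markAt_self_notMem hx hL hxL
    obtain ⟨a, ha, haq⟩ := key hI hK
    obtain ⟨b, hb, hbq⟩ := key hJ hM
    -- The product $ab$ enters the product ideal via conjugation by 1 and a trivial transfer,
    -- neither of which changes marks.
    have hab := mem_markIdeal_idealOn.1 (hIJ (conjSubgroup 1 H) _ (AddSubmonoid.subset_closure
      ⟨H, 1, le_rfl, a, ha, b, hb, rfl⟩)) H Set.self_mem_Iic
    rw [markAt_tr_self, markAt_conj, map_mul] at hab
    exact hq.mul_notMem haq hbq hab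

end CommGroup

end BurnsideTambara

theorem lemma5p2 {G : Type u} [CommGroup G] [Finite G] (I : Subgroup G)
    (P : BurnsideTambara.IdealFamily G) (hP : BurnsideTambara.IsPrimeTambaraIdeal P) :
    BurnsideTambara.IsPrimeTambaraIdeal (BurnsideTambara.restrict P I) := by
  obtain ⟨H, q, hq, rfl⟩ := hP.exists_eq_markIdeal
  rw [BurnsideTambara.restrict_markIdeal]
  exact BurnsideTambara.isPrimeTambaraIdeal_markIdeal _ hq
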